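/- Let $M$ be a connected compact topological manifold, possibly with boundary, with a compatible metric, let $\varphi$ be a continuous flow on $M$, and fix $T>0$. Let $\alpha\in H^1(M,\mathbb R)$. Let $\widehat M\to M$ be the universal Abelian covering (with deck group $H_1(M,\mathbb Z)$), and $\widehat M_\alpha=\widehat M/\ker_{\mathbb Z}(\alpha)$, where $\ker_{\mathbb Z}(\alpha)=\{\delta\in H_1(M,\mathbb Z):\alpha(\delta)=0\}$. Each is equipped with the lifted flow and with any compatible metric that is invariant under deck transformations and for which the covering map restricts to an isometry onto its image on all sufficiently small balls. An $(\epsilon,T)$-pseudo-orbit of length $l>0$ is a right-continuous curve $\gamma$ on $[0,l[$ that is continuous outside a finite set $\Delta$ disjoint from $[0,T[$ whose points are at distance at least $T$ from each other, that follows the flow on every interval on which it is continuous, and for which $\gamma(u)$ and $\gamma(u^-)=\lim_{s\to u^-}\gamma(s)$ are at distance less than $\epsilon$ for every $u\in\Delta$. A periodic $(\epsilon,T)$-pseudo-orbit of length $\mathrm{len}(\gamma)=l$ is similarly a curve $\gamma\colon\mathbb R/l\mathbb Z\to M$, consecutive discontinuities (of its $l$-periodic lift to $\mathbb R$) being at distance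 at least $T$. Its class $[\gamma]\in H_1(M,\mathbb R)$ is the class of an $\epsilon$-realization, that is, of a closed curve obtained by inserting in $\gamma$, at each discontinuity $u$, a continuous curve from $\gamma(u^-)$ to $\gamma(u)$ inside the $\epsilon$-ball centred at $\gamma(u)$. Call $\epsilon>0$ small if any two curves with the same ends that lie in a common $\epsilon$-ball are homotopic in $M$ relative to their ends (so that $[\gamma]$ does not depend on the realization), and let $$D_{\varphi,\epsilon,T}=\overline{\left\{\tfrac1{\mathrm{len}(\gamma)}[\gamma] : \gamma\text{ a periodic }(\epsilon,T)\text{-pseudo-orbit in }M\right\}}\subset H_1(M,\mathbb R).$$ A continuous function $f$ on $\widehat M_\alpha$ (or $\widehat M$) is $\alpha$-equivariant if $f(\delta\cdot x)=\alpha(\delta)+f(x)$ for all $x$ and all $\delta\in H_1(M,\mathbb Z)$. It is quasi-Lyapunov if there are $C\ge 0$ and $\epsilon>0$ such that $f(\gamma(0))\ge f(\gamma(t))-C$ for every $(\epsilon,T)$-pseudo-orbit $\gamma$ of the lifted flow and every $t\in[0,\mathrm{len}(\gamma)[$. The class $\alpha$ is quasi-Lyapunov if every continuous $\alpha$-equivariant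 function is quasi-Lyapunov. Then the following conditions are equivalent: 1. $\alpha$ is quasi-Lyapunov, with functions on $\widehat M_\alpha$; 2. $\alpha$ is quasi-Lyapunov, with functions on $\widehat M$; 3. $\alpha(D_{\varphi,\epsilon,T})\le 0$ for some small $\epsilon>0$; 4. there is $\epsilon_0>0$ such that every $\epsilon\in{]0,\epsilon_0[}$ is small and satisfies $\alpha(D_{\varphi,\epsilon,T})\le 0$; 5. for some small $\epsilon>0$, every periodic $(\epsilon,T)$-pseudo-orbit $\gamma$ in $M$ satisfies $\alpha([\gamma])\le 0$; 6. there is $\epsilon_0>0$ such that every $\epsilon\in{]0,\epsilon_0[}$ is small and every periodic $(\epsilon,T)$-pseudo-orbit $\gamma$ in $M$ satisfies $\alpha([\gamma])\le 0$. -/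

import Mathlib

open Set Filter Topology

noncomputable section

namespace QuasiLyapunov

/-! ### Singular homology and cohomology in degree one -/

/-- Singular `n`-simplices of `X`. -/
abbrev Simplex (n : ℕ) (X : Type*) [TopologicalSpace X] : Type _ :=
  C(stdSimplex ℝ (Fin (n + 1)), X)

/-- The inclusion of the `i`-th face (the one opposite to the vertex `i`) of the standard
simplex. -/
def faceMap (n : ℕ) (i : Fin (n + 2)) :
    C(stdSimplex ℝ (Fin (n + 1)), stdSimplex ℝ (Fin (n + 2))) :=
  ⟨stdSimplex.map i.succAbove, stdSimplex.continuous_map _⟩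

variable (R : Type) [CommRing R] {X : Type*} [TopologicalSpace X]

/-- The `i`-th face of a singular simplex. -/
def face {n : ℕ} (σ : Simplex (n + 1) X) (i : Fin (n + 2)) : Simplex n X :=
  σ.comp (faceMap n i)

variable (X) in
/-- Singular `n`-chains with coefficients in `R`. -/
def Chain (n : ℕ) : Type _ := Simplex n X →₀ R

instance (n : ℕ) : AddCommGroup (Chain R X n) :=
  inferInstanceAs (AddCommGroup (Simplex n X →₀ R))

instance (n : ℕ) : Module R (Chain R X n) :=
  inferInstanceAs (Module R (Simplex n X →₀ R))

/-- A singular simplex, seen as a chain. -/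
def single {n : ℕ} (σ : Simplex n X) : Chain R X n := Finsupp.single σ (1 : R)

/-- The extension by linearity to the chains of a function on the singular simplices. -/
def extend {n : ℕ} {V : Type*} [AddCommGroup V] [Module R V] (F : Simplex n X → V) :
    Chain R X n →ₗ[R] V :=
  Finsupp.linearCombination R F

@[simp]
theorem extend_single {n : ℕ} {V : Type*} [AddCommGroup V] [Module R V] (F : Simplex n X → V)
    (σ : Simplex n X) : extend R F (single R σ) = F σ := by
  have h := Finsupp.linearCombination_single R (1 : R) σ (v := F)
  rw [one_smul] at h
  exact h

theorem chain_hom_ext {n : ℕ} {V : Type*} [AddCommGroup V] [Module R V]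
    {f g : Chain R X n →ₗ[R] V} (h : ∀ σ, f (single R σ) = g (single R σ)) : f = g :=
  Finsupp.lhom_ext' fun σ => LinearMap.ext_ring (h σ)

theorem extend_sub {n : ℕ} {V : Type*} [AddCommGroup V] [Module R V] (F G : Simplex n X → V) :
    extend R (F - G) = extend R F - extend R G :=
  chain_hom_ext R fun σ => by simp

variable (X) in
/-- The boundary map on singular chains, `∂σ = ∑ (-1)^i (i-th face of σ)`. -/
def boundary (n : ℕ) : Chain R X (n + 1) →ₗ[R] Chain R X n :=
  extend R fun σ : Simplex (n + 1) X =>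
    ∑ i : Fin (n + 2), ((-1 : ℤ) ^ (i : ℕ)) • single R (face σ i)

variable (X) in
/-- Singular 1-cycles. -/
abbrev Cycles : Submodule R (Chain R X 1) := LinearMap.ker (boundary R X 0)

variable (X) in
/-- Singular 1-boundaries, seen inside the 1-cycles. -/
abbrev Boundaries : Submodule R (Cycles R X) :=
  (LinearMap.range (boundary R X 1)).submoduleOf (Cycles R X)

variable (X) in
/-- The first singular homology `H₁(X, R)`. -/
abbrev H1 : Type _ := Cycles R X ⧸ Boundaries R X

variable (X) in
/-- The coboundary map on real singular cochains. -/
def coboundary (n : ℕ) : (Simplex n X → ℝ) →ₗ[ℝ] (Simplex (n + 1) X → ℝ) where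
  toFun c σ := ∑ i : Fin (n + 2), ((-1 : ℤ) ^ (i : ℕ)) • c (face σ i)
  map_add' c c' := by
    funext σ
    simp [Finset.sum_add_distrib]
  map_smul' a c := by
    funext σ
    simp only [Pi.smul_apply, RingHom.id_apply, Finset.smul_sum]
    exact Finset.sum_congr rfl fun i _ => smul_comm _ _ _

variable (X) in
/-- Real singular 1-cocycles. -/
abbrev Cocycles : Submodule ℝ (Simplex 1 X → ℝ) := LinearMap.ker (coboundary X 1)

variable (X) in
/-- The first real singular cohomology `H¹(X, ℝ)`: cocycles modulo coboundaries. -/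
abbrev Cohomology : Type _ :=
  Cocycles X ⧸ (LinearMap.range (coboundary X 0)).submoduleOf (Cocycles X)

section pairing

variable [Module R ℝ]

theorem extend_boundary {n : ℕ} (c : Simplex n X → ℝ) (z : Chain R X (n + 1)) :
    extend R c (boundary R X n z) = extend R (coboundary X n c) z := by
  have h : (extend R c).comp (boundary R X n) = extend R (coboundary X n c) :=
    chain_hom_ext R fun σ => by
      simp [boundary, coboundary, map_sum, -zsmul_eq_mul]
  exact LinearMap.congr_fun h z

/-- A cocycle, evaluated on homology classes. -/
def evalCocycle (c : Cocycles X) : H1 R X →ₗ[R] ℝ :=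
  Submodule.liftQ _ ((extend R c.1).comp (Cycles R X).subtype) <| by
    rintro ⟨z, hz⟩ ⟨w, hw⟩
    have hw' : boundary R X 1 w = z := hw
    have hc : coboundary X 1 c.1 = 0 := c.2
    have h := extend_boundary R c.1 w
    have h0 : extend R (0 : Simplex 2 X → ℝ) = 0 := chain_hom_ext R fun σ => by simp
    rw [hw', hc, h0] at h
    exact h

/-- The Kronecker pairing `α ↦ (δ ↦ α(δ))` of `H¹(X, ℝ)` with `H₁(X, R)` (for `R = ℤ` and
`R = ℝ`): a class is evaluated on cycles through any of its cocycles. -/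
def eval (α : Cohomology X) : H1 R X →ₗ[R] ℝ :=
  Quotient.liftOn' α (evalCocycle R) <| by
    intro c c' h
    rw [Submodule.quotientRel_def] at h
    obtain ⟨b, hb⟩ := h
    have hb' : coboundary X 0 b = c.1 - c'.1 := hb
    refine Submodule.linearMap_qext _ (LinearMap.ext fun z => ?_)
    have h0 : extend R (coboundary X 0 b) z.1 = 0 := by
      rw [← extend_boundary, show boundary R X 0 z.1 = 0 from z.2, map_zero]
    have h1 : extend R c.1 z.1 - extend R c'.1 z.1 = 0 := by
      rw [← h0, hb', extend_sub]
      rfl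
    exact sub_eq_zero.1 h1

end pairing

/-! ### Curves as singular simplices -/

/-- A curve `[0,1] → X` as a singular 1-simplex. -/
def curveSimplex (p : C(unitInterval, X)) : Simplex 1 X :=
  p.comp (stdSimplexHomeomorphUnitInterval : C(stdSimplex ℝ (Fin 2), unitInterval))

/-- A curve as a singular 1-chain. -/
def curveChain (p : C(unitInterval, X)) : Chain R X 1 := single R (curveSimplex p)

/-- A point as a singular 0-simplex. -/
def pointSimplex (x : X) : Simplex 0 X := ContinuousMap.const _ x

theorem face_curveSimplex_zero (p : C(unitInterval, X)) :
    face (curveSimplex p) 0 = pointSimplex (p 1) := by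
  ext v
  have hv : v = stdSimplex.vertex 0 := Subsingleton.elim _ _
  subst hv
  simp only [face, curveSimplex, faceMap, pointSimplex, ContinuousMap.comp_apply,
    ContinuousMap.coe_mk, ContinuousMap.const_apply, stdSimplex.map_vertex]
  rfl

theorem face_curveSimplex_one (p : C(unitInterval, X)) :
    face (curveSimplex p) 1 = pointSimplex (p 0) := by
  ext v
  have hv : v = stdSimplex.vertex 0 := Subsingleton.elim _ _
  subst hv
  simp only [face, curveSimplex, faceMap, pointSimplex, ContinuousMap.comp_apply,
    ContinuousMap.coe_mk, ContinuousMap.const_apply, stdSimplex.map_vertex]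
  rfl

theorem boundary_curveChain (p : C(unitInterval, X)) :
    boundary R X 0 (curveChain R p) =
      single R (pointSimplex (p 1)) - single R (pointSimplex (p 0)) := by
  simp [boundary, curveChain, Fin.sum_univ_two, face_curveSimplex_zero, face_curveSimplex_one,
    sub_eq_add_neg]

/-- The homology class of a closed curve. -/
def loopClass (p : C(unitInterval, X)) (h : p 0 = p 1) : H1 R X :=
  Submodule.Quotient.mk ⟨curveChain R p, by
    rw [LinearMap.mem_ker, boundary_curveChain, h, sub_self]⟩

/-- The homology class of the cycle `p - q`, for two curves with the same ends. -/
def diffClass (p q : C(unitInterval, X)) (h0 : p 0 = q 0) (h1 : p 1 = q 1) : H1 R X :=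
  Submodule.Quotient.mk ⟨curveChain R p - curveChain R q, by
    rw [LinearMap.mem_ker, map_sub, boundary_curveChain, boundary_curveChain, h0, h1, sub_self]⟩

/-- The map `(x₀, x₁, x₂) ↦ x₁ / 2 + x₂` from the triangle to the unit interval. -/
def triangleMap : C(stdSimplex ℝ (Fin 3), unitInterval) :=
  ⟨fun v => ⟨v.1 1 / 2 + v.1 2, by
      have h0 := v.2.1 0
      have h1 := v.2.1 1
      have h2 := v.2.1 2
      have h := v.2.2
      rw [Fin.sum_univ_three] at h
      constructor <;> linarith⟩, by
    refine Continuous.subtype_mk ?_ _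
    exact (((continuous_apply 1).comp continuous_subtype_val).div_const 2).add
      ((continuous_apply 2).comp continuous_subtype_val)⟩

theorem triangleMap_face_zero (v : stdSimplex ℝ (Fin 2)) :
    (triangleMap (faceMap 1 0 v) : ℝ) = (1 + v.1 1) / 2 := by
  have h := v.2.2
  rw [Fin.sum_univ_two] at h
  have h1 : (faceMap 1 0 v).1 1 = v.1 0 := by
    change stdSimplex.map _ v 1 = v 0
    simp [FunOnFinite.linearMap_apply_apply, Finset.sum_filter, Fin.sum_univ_two]
  have h2 : (faceMap 1 0 v).1 2 = v.1 1 := by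
    change stdSimplex.map _ v 2 = v 1
    simp [FunOnFinite.linearMap_apply_apply, Finset.sum_filter, Fin.sum_univ_two, Fin.ext_iff]
  change (faceMap 1 0 v).1 1 / 2 + (faceMap 1 0 v).1 2 = _
  rw [h1, h2]
  linarith

theorem triangleMap_face_one (v : stdSimplex ℝ (Fin 2)) :
    (triangleMap (faceMap 1 1 v) : ℝ) = v.1 1 := by
  have h1 : (faceMap 1 1 v).1 1 = 0 := by
    change stdSimplex.map _ v 1 = 0
    simp [FunOnFinite.linearMap_apply_apply, Fin.succAbove_ne]
  have e0 : (1 : Fin 3).succAbove (0 : Fin 2) ≠ 2 := by decide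
  have e1 : (1 : Fin 3).succAbove (1 : Fin 2) = 2 := by decide
  have h2 : (faceMap 1 1 v).1 2 = v.1 1 := by
    change stdSimplex.map _ v 2 = v 1
    rw [stdSimplex.map_coe, FunOnFinite.linearMap_apply_apply, Finset.sum_filter,
      Fin.sum_univ_two, if_neg e0, if_pos e1, zero_add]
  change (faceMap 1 1 v).1 1 / 2 + (faceMap 1 1 v).1 2 = _
  rw [h1, h2]
  simp

theorem triangleMap_face_two (v : stdSimplex ℝ (Fin 2)) :
    (triangleMap (faceMap 1 2 v) : ℝ) = v.1 1 / 2 := by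
  have h1 : (faceMap 1 2 v).1 1 = v.1 1 := by
    change stdSimplex.map _ v 1 = v 1
    simp [FunOnFinite.linearMap_apply_apply, Finset.sum_filter, Fin.sum_univ_two, Fin.ext_iff,
      Fin.succAbove]
  have h2 : (faceMap 1 2 v).1 2 = 0 := by
    change stdSimplex.map _ v 2 = 0
    simp [FunOnFinite.linearMap_apply_apply, Fin.succAbove_ne]
  change (faceMap 1 2 v).1 1 / 2 + (faceMap 1 2 v).1 2 = _
  rw [h1, h2, add_zero]

/-- A concatenation of curves is homologous to their sum. -/
theorem curveChain_trans {x y z : X} (p : Path x y) (q : Path y z) :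
    curveChain R p.toContinuousMap + curveChain R q.toContinuousMap
      - curveChain R (p.trans q).toContinuousMap ∈ LinearMap.range (boundary R X 1) := by
  have hnn : ∀ v : stdSimplex ℝ (Fin 2), 0 ≤ v.1 1 ∧ v.1 1 ≤ 1 := fun v =>
    mem_Icc_of_mem_stdSimplex v.2 1
  have f0 : face ((p.trans q).toContinuousMap.comp triangleMap) 0
      = curveSimplex q.toContinuousMap := by
    ext v
    change (p.trans q) (triangleMap (faceMap 1 0 v)) = q (stdSimplexHomeomorphUnitInterval v)
    rw [Path.trans_apply]
    split_ifs with h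
    · have hv : v.1 1 = 0 := by
        have h' := triangleMap_face_zero v
        have := hnn v
        linarith
      have e1 : (⟨2 * (triangleMap (faceMap 1 0 v) : ℝ),
          (unitInterval.mul_pos_mem_iff zero_lt_two).2 ⟨(triangleMap _).2.1, h⟩⟩ :
            unitInterval) = 1 := by
        ext1
        change 2 * (triangleMap (faceMap 1 0 v) : ℝ) = 1
        rw [triangleMap_face_zero, hv]
        norm_num
      have e2 : stdSimplexHomeomorphUnitInterval v = 0 := Subtype.ext hv
      rw [e1, e2, p.target, q.source]
    · congr 1
      ext1
      change 2 * (triangleMap (faceMap 1 0 v) : ℝ) - 1 = v.1 1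
      rw [triangleMap_face_zero]
      ring
  have f1 : face ((p.trans q).toContinuousMap.comp triangleMap) 1
      = curveSimplex (p.trans q).toContinuousMap := by
    ext v
    change (p.trans q) (triangleMap (faceMap 1 1 v))
      = (p.trans q) (stdSimplexHomeomorphUnitInterval v)
    congr 1
    ext1
    exact triangleMap_face_one v
  have f2 : face ((p.trans q).toContinuousMap.comp triangleMap) 2
      = curveSimplex p.toContinuousMap := by
    ext v
    change (p.trans q) (triangleMap (faceMap 1 2 v)) = p (stdSimplexHomeomorphUnitInterval v)
    have h : (triangleMap (faceMap 1 2 v) : ℝ) ≤ 1 / 2 := by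
      rw [triangleMap_face_two]
      have := hnn v
      linarith
    rw [Path.trans_apply, dif_pos h]
    congr 1
    ext1
    change 2 * (triangleMap (faceMap 1 2 v) : ℝ) = v.1 1
    rw [triangleMap_face_two]
    ring
  refine ⟨single R ((p.trans q).toContinuousMap.comp triangleMap), ?_⟩
  have hb : boundary R X 1 (single R ((p.trans q).toContinuousMap.comp triangleMap)) =
      ∑ i : Fin 3, ((-1 : ℤ) ^ (i : ℕ)) •
        single R (face ((p.trans q).toContinuousMap.comp triangleMap) i) :=
    extend_single R _ _
  rw [hb, Fin.sum_univ_three, f0, f1, f2]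
  simp only [curveChain, Fin.val_zero, Fin.val_one, Fin.val_two, pow_zero, pow_one, one_smul,
    neg_smul, even_two, Even.neg_pow, one_pow]
  abel

/-! ### The Abelian coverings -/

/-- The curves in `X` that start at `x₀`, with the compact-open topology. -/
abbrev PathSpace (x₀ : X) : Type _ := {p : C(unitInterval, X) // p 0 = x₀}

namespace PathSpace

variable {x₀ : X}

/-- The end of a curve. -/
def endpoint (p : PathSpace x₀) : X := p.1 1

/-- An element of the path space as a path. -/
def toPath (p : PathSpace x₀) : Path x₀ p.endpoint := ⟨p.1, p.2, rfl⟩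

/-- The curve `p` followed by the curve `a`. -/
def append (p : PathSpace x₀) {y : X} (a : Path p.endpoint y) : PathSpace x₀ :=
  ⟨(p.toPath.trans a).toContinuousMap, (p.toPath.trans a).source⟩

theorem endpoint_append (p : PathSpace x₀) {y : X} (a : Path p.endpoint y) :
    (p.append a).endpoint = y :=
  (p.toPath.trans a).target

/-- The class in `H₁(X, ℤ)` of `p - q`, for two curves that start at `x₀` and have the same
end. -/
def diff (p q : PathSpace x₀) (h : p.endpoint = q.endpoint) : H1 ℤ X :=
  diffClass ℤ p.1 q.1 (p.2.trans q.2.symm) h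

end PathSpace

/-- Two curves that start at `x₀` are identified when they have the same end and when their
difference lies in the subgroup `K` of `H₁(X, ℤ)`. -/
def coverSetoid (x₀ : X) (K : Submodule ℤ (H1 ℤ X)) : Setoid (PathSpace x₀) where
  r p q := ∃ h : p.endpoint = q.endpoint, p.diff q h ∈ K
  iseqv := by
    refine ⟨fun p => ⟨rfl, ?_⟩, ?_, ?_⟩
    · have h : p.diff p rfl = 0 := by
        simp only [PathSpace.diff, diffClass, sub_self]
        rfl
      rw [h]
      exact K.zero_mem
    · rintro p q ⟨h, hK⟩
      refine ⟨h.symm, ?_⟩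
      have h' : q.diff p h.symm = -p.diff q h := by
        simp only [PathSpace.diff, diffClass, ← Submodule.Quotient.mk_neg]
        congr 1
        ext1
        simp
      rw [h']
      exact K.neg_mem hK
    · rintro p q r ⟨h, hK⟩ ⟨h', hK'⟩
      refine ⟨h.trans h', ?_⟩
      have e : p.diff r (h.trans h') = p.diff q h + q.diff r h' := by
        simp only [PathSpace.diff, diffClass, ← Submodule.Quotient.mk_add]
        congr 1
        ext1
        simp
      rw [e]
      exact K.add_mem hK hK'

/-- The connected Abelian covering of `X` whose closed curves are the closed curves of `X` with
homology class in `K ≤ H₁(X, ℤ)`, with the quotient topology. For `K = ⊥` this is the universal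
Abelian covering, and for general `K` its quotient by `K`. -/
def Cover (x₀ : X) (K : Submodule ℤ (H1 ℤ X)) : Type _ := Quotient (coverSetoid x₀ K)

namespace Cover

variable {x₀ : X} {K : Submodule ℤ (H1 ℤ X)}

instance : TopologicalSpace (Cover x₀ K) :=
  inferInstanceAs (TopologicalSpace (Quotient (coverSetoid x₀ K)))

/-- The point of the covering represented by a curve. -/
def mk (K : Submodule ℤ (H1 ℤ X)) (p : PathSpace x₀) : Cover x₀ K :=
  Quotient.mk (coverSetoid x₀ K) p

/-- The covering map. -/
def proj (x : Cover x₀ K) : X :=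
  Quotient.liftOn x PathSpace.endpoint fun _ _ h => h.1

/-- `IsTranslate δ x y` says that `y = δ · x`, for the action of `H₁(X, ℤ)` by deck
transformations: `y` is represented by `ℓ · p` and `x` by `p`, with `ℓ` a loop of class `δ`. -/
def IsTranslate (δ : H1 ℤ X) (x y : Cover x₀ K) : Prop :=
  ∃ (p q : PathSpace x₀) (h : q.endpoint = p.endpoint),
    mk K p = x ∧ mk K q = y ∧ q.diff p h = δ

end Cover

/-- A real function on a covering is `α`-equivariant if `f (δ · x) = α(δ) + f x`. -/
def IsEquivariant {x₀ : X} {K : Submodule ℤ (H1 ℤ X)} (α : Cohomology X)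
    (f : Cover x₀ K → ℝ) : Prop :=
  ∀ (δ : H1 ℤ X) (x y : Cover x₀ K), Cover.IsTranslate δ x y → f y = eval ℤ α δ + f x

/-- `ker_ℤ(α) ⊆ H₁(X, ℤ)`. -/
abbrev intKer (α : Cohomology X) : Submodule ℤ (H1 ℤ X) := LinearMap.ker (eval ℤ α)

/-- The orbit arc `s ↦ φ_{st}(x)`, `0 ≤ s ≤ 1`, from `x` to `φ_t(x)`. -/
def orbitArc (φ : Flow ℝ X) (t : ℝ) (x : X) : Path x (φ t x) where
  toFun s := φ (s * t) x
  continuous_toFun := φ.continuous (by fun_prop) continuous_const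
  source' := by simp [φ.map_zero_apply]
  target' := by simp

theorem diff_append {x₀ : X} (p q : PathSpace x₀) (h : p.endpoint = q.endpoint) {y z : X}
    (a : Path p.endpoint y) (b : Path q.endpoint z)
    (hab : a.toContinuousMap = b.toContinuousMap)
    (h' : (p.append a).endpoint = (q.append b).endpoint) :
    (p.append a).diff (q.append b) h' = p.diff q h := by
  have e := Submodule.sub_mem _ (curveChain_trans ℤ q.toPath b) (curveChain_trans ℤ p.toPath a)
  refine (Submodule.Quotient.eq _).2 ?_
  change curveChain ℤ (p.toPath.trans a).toContinuousMap
      - curveChain ℤ (q.toPath.trans b).toContinuousMap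
      - (curveChain ℤ p.toPath.toContinuousMap - curveChain ℤ q.toPath.toContinuousMap)
      ∈ LinearMap.range (boundary ℤ X 1)
  rw [hab] at e
  convert e using 1
  abel

/-- The lift of a flow to a covering: the curve `p` is prolonged by the orbit of its end. -/
def liftFlow (φ : Flow ℝ X) {x₀ : X} {K : Submodule ℤ (H1 ℤ X)} (t : ℝ) :
    Cover x₀ K → Cover x₀ K :=
  Quotient.map (fun p => p.append (orbitArc φ t p.endpoint)) <| by
    rintro p q ⟨h, hK⟩
    have h' : (p.append (orbitArc φ t p.endpoint)).endpoint
        = (q.append (orbitArc φ t q.endpoint)).endpoint := by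
      rw [PathSpace.endpoint_append, PathSpace.endpoint_append, h]
    refine ⟨h', ?_⟩
    rw [diff_append p q h _ _ (by rw [h]) h']
    exact hK

/-! ### Metrics on the coverings -/

/-- `d` is one of the metrics used on a covering of the metric space `X`: it is a metric that
induces the topology, it is invariant under deck transformations, and the covering map restricted
to any small enough ball is an isometry onto its image. -/
structure IsLiftedMetric {X : Type*} [MetricSpace X] {x₀ : X} {K : Submodule ℤ (H1 ℤ X)}
    (d : Cover x₀ K → Cover x₀ K → ℝ) : Prop where
  eq_zero_iff : ∀ x y, d x y = 0 ↔ x = y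
  symm : ∀ x y, d x y = d y x
  triangle : ∀ x y z, d x z ≤ d x y + d y z
  isOpen_iff : ∀ U : Set (Cover x₀ K), IsOpen U ↔ ∀ x ∈ U, ∃ η > 0, ∀ y, d x y < η → y ∈ U
  deck_invariant : ∀ (δ : H1 ℤ X) (x y x' y' : Cover x₀ K),
    Cover.IsTranslate δ x x' → Cover.IsTranslate δ y y' → d x' y' = d x y
  isometry_on_balls : ∃ r > 0, ∀ x y z : Cover x₀ K, d x y < r → d x z < r →
    dist y.proj z.proj = d y z

/-! ### Pseudo-orbits -/

/-- The `(ε, T)`-pseudo-orbits `γ : [0, l[ → N` of `ψ` (values outside `[0, l[` are ignored).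
The discontinuity set is finite, disjoint from `[0, T[`, and its points are distant by at least
`T`. -/
structure IsPseudoOrbit {N : Type*} [TopologicalSpace N] (ψ : ℝ → N → N) (d : N → N → ℝ)
    (ε T l : ℝ) (γ : ℝ → N) : Prop where
  length_pos : 0 < l
  right_continuous : ∀ t ∈ Ico 0 l, ContinuousWithinAt γ (Ico t l) t
  finite : {u ∈ Ico 0 l | ¬ ContinuousWithinAt γ (Ico 0 l) u}.Finite
  disjoint : ∀ u ∈ Ico 0 l, ¬ ContinuousWithinAt γ (Ico 0 l) u → T ≤ u
  spacing : ∀ u ∈ Ico 0 l, ∀ v ∈ Ico 0 l, ¬ ContinuousWithinAt γ (Ico 0 l) u →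
    ¬ ContinuousWithinAt γ (Ico 0 l) v → u < v → T ≤ v - u
  orbit : ∀ t s, 0 ≤ t → t ≤ s → s < l → ContinuousOn γ (Icc t s) → γ s = ψ (s - t) (γ t)
  jump : ∀ u ∈ Ico 0 l, ¬ ContinuousWithinAt γ (Ico 0 l) u →
    ∃ y, Tendsto γ (𝓝[<] u) (𝓝 y) ∧ d (γ u) y < ε

section

variable {M : Type*} [MetricSpace M]

/-- The periodic `(ε, T)`-pseudo-orbits `γ : ℝ / lℤ → M`, seen as `l`-periodic functions on
`ℝ`. -/
structure IsPeriodicPseudoOrbit (φ : Flow ℝ M) (ε T l : ℝ) (γ : ℝ → M) : Prop where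
  length_pos : 0 < l
  periodic : Function.Periodic γ l
  right_continuous : ∀ t, ContinuousWithinAt γ (Ici t) t
  finite : {u ∈ Ico 0 l | ¬ ContinuousAt γ u}.Finite
  spacing : ∀ u v, ¬ ContinuousAt γ u → ¬ ContinuousAt γ v → u < v → T ≤ v - u
  orbit : ∀ t s, t ≤ s → ContinuousOn γ (Icc t s) → γ s = φ (s - t) (γ t)
  jump : ∀ u, ¬ ContinuousAt γ u → ∃ y, Tendsto γ (𝓝[<] u) (𝓝 y) ∧ dist (γ u) y < ε

/-- `Γ` is an `ε`-realization of the periodic pseudo-orbit `γ` of length `l`: a closed curve that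
runs through `γ` once and in which, at each discontinuity time `u`, a curve from `γ(u⁻)` to `γ(u)`
in the `ε`-ball centred at `γ(u)` is inserted. The function `τ` sends the parameter of `Γ` to the
time of `γ`; it is constant equal to `u` on the inserted curve, whose ends are `γ(u⁻)` and `γ(u)`
by continuity of `Γ`. -/
structure IsRealization (ε l : ℝ) (γ : ℝ → M) (Γ : C(unitInterval, M)) : Prop where
  closed : Γ 0 = Γ 1
  exists_time : ∃ τ : C(unitInterval, ℝ), Monotone τ ∧ τ 1 = τ 0 + l ∧
    ∀ s, (ContinuousAt γ (τ s) → Γ s = γ (τ s)) ∧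
      (¬ ContinuousAt γ (τ s) → Γ s ∈ Metric.ball (γ (τ s)) ε)

/-- `h = [γ]`: the class `h` in `H₁(M, ℝ)` is the class of an `ε`-realization of the periodic
pseudo-orbit `γ` of length `l`. -/
def IsClassOf (ε l : ℝ) (γ : ℝ → M) (h : H1 ℝ M) : Prop :=
  ∃ (Γ : C(unitInterval, M)) (hΓ : IsRealization ε l γ Γ), h = loopClass ℝ Γ hΓ.closed

variable (M) in
/-- `ε` is small: any two curves with the same ends that remain in a common `ε`-ball are
homotopic in `M` relatively to their ends. -/
def IsSmall (ε : ℝ) : Prop :=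
  ∀ (z x y : M) (p q : Path x y), (∀ t, p t ∈ Metric.ball z ε) → (∀ t, q t ∈ Metric.ball z ε) →
    p.Homotopic q

/-- The set `D_{φ,ε,T}`: the closure in `H₁(M, ℝ)` of the set of all `[γ] / len(γ)`, for the
periodic `(ε, T)`-pseudo-orbits `γ`. The topology on the real vector space `H₁(M, ℝ)` is its
canonical one (in finite dimension, the unique Hausdorff vector space topology). -/
def pseudoDirections (φ : Flow ℝ M) (ε T : ℝ) : Set (H1 ℝ M) :=
  @closure (H1 ℝ M) (moduleTopology ℝ (H1 ℝ M))
    {v | ∃ (l : ℝ) (γ : ℝ → M) (h : H1 ℝ M),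
      IsPeriodicPseudoOrbit φ ε T l γ ∧ IsClassOf ε l γ h ∧ v = l⁻¹ • h}

/-! ### Quasi-Lyapunov classes -/

variable {x₀ : M} {K : Submodule ℤ (H1 ℤ M)}

/-- `f` is `C`-quasi-Lyapunov for the lifted flow. -/
def IsQuasiLyapunovMapWith (φ : Flow ℝ M) (T : ℝ) (d : Cover x₀ K → Cover x₀ K → ℝ)
    (C : ℝ) (f : Cover x₀ K → ℝ) : Prop :=
  ∃ ε > 0, ∀ (l : ℝ) (γ : ℝ → Cover x₀ K), IsPseudoOrbit (liftFlow φ) d ε T l γ →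
    ∀ t ∈ Ico 0 l, f (γ 0) ≥ f (γ t) - C

/-- `f` is quasi-Lyapunov. -/
def IsQuasiLyapunovMap (φ : Flow ℝ M) (T : ℝ) (d : Cover x₀ K → Cover x₀ K → ℝ)
    (f : Cover x₀ K → ℝ) : Prop :=
  ∃ C ≥ 0, IsQuasiLyapunovMapWith φ T d C f

/-- `α` is quasi-Lyapunov: on the covering (with metric `d`), every continuous `α`-equivariant
function is quasi-Lyapunov. -/
def IsQuasiLyapunov (φ : Flow ℝ M) (T : ℝ) (d : Cover x₀ K → Cover x₀ K → ℝ)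
    (α : Cohomology M) : Prop :=
  ∀ f : Cover x₀ K → ℝ, Continuous f → IsEquivariant α f → IsQuasiLyapunovMap φ T d f

end

end QuasiLyapunov

end

open QuasiLyapunov

/-!
A continuous `α`-equivariant function `f` on a covering is, up to a bounded error, the integral of
a cocycle `c` of class `α` along curves. A periodic pseudo-orbit `γ` of `M`, lifted to the covering
and run `k` times, is a pseudo-orbit along which `f` grows by `k * α([γ])`; a bound on the growth
of `f` along all pseudo-orbits thus forces `α([γ]) ≤ 0`.

Conversely, cut a pseudo-orbit of the covering into orbit arcs of durations in `[T, 2T]`, and cover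
`M` by `n` balls so small that a chain of arcs which starts and ends in a common ball closes up to
a periodic pseudo-orbit. If `α` is nonpositive on these, then each such chain raises `f` by a
bounded amount only; cutting out, color by color, the part of the pseudo-orbit between the first
and the last visit of a ball leaves at most `n` arcs, so that the total growth of `f` is bounded.
-/

noncomputable section

namespace QuasiLyapunov

/-! ### Local topology of compact manifolds -/

theorem locallyPathConnectedSpace_of_modelWithCorners {E H : Type*} [NormedAddCommGroup E]
    [NormedSpace ℝ E] [TopologicalSpace H] (I : ModelWithCorners ℝ E H) (M : Type*)
    [TopologicalSpace M] [ChartedSpace H M] : LocallyPathConnectedSpace M := by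
  have : LocallyPathConnectedSpace (range I) := I.convex_range.locallyPathConnectedSpace
  have : LocallyPathConnectedSpace H :=
    (I.isClosedEmbedding.isEmbedding.toHomeomorph.isOpenEmbedding).locallyPathConnectedSpace
  exact ChartedSpace.locallyPathConnectedSpace H M

theorem homotopic_of_comp_eq {X Y : Type*} [TopologicalSpace X] [TopologicalSpace Y]
    [SimplyConnectedSpace Y] {g : Y → X} (hg : Continuous g) {u v : Y} (p' q' : Path u v) {x y : X}
    {p q : Path x y} (hp : ∀ t, g (p' t) = p t) (hq : ∀ t, g (q' t) = q t) : p.Homotopic q := by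
  obtain rfl : g u = x := by simpa using hp 0
  obtain rfl : g v = y := by simpa using hp 1
  have h := (SimplyConnectedSpace.paths_homotopic p' q').map ⟨g, hg⟩
  rwa [show p'.map hg = p from Path.ext (funext hp),
    show q'.map hg = q from Path.ext (funext hq)] at h

theorem exists_isOpen_forall_homotopic {E H : Type*} [NormedAddCommGroup E]
    [NormedSpace ℝ E] [TopologicalSpace H] (I : ModelWithCorners ℝ E H) {M : Type*}
    [TopologicalSpace M] [ChartedSpace H M] (z : M) :
    ∃ U : Set M, IsOpen U ∧ z ∈ U ∧ ∀ (x y : M) (p q : Path x y), (∀ t, p t ∈ U) →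
      (∀ t, q t ∈ U) → p.Homotopic q := by
  set e := extChartAt I z
  obtain ⟨ρ, hρ, hsub⟩ := Metric.mem_nhdsWithin_iff.1 (extChartAt_target_mem_nhdsWithin (I := I) z)
  let C : Set E := Metric.ball (e z) ρ ∩ range I
  have hzC : e z ∈ C := ⟨Metric.mem_ball_self hρ, extChartAt_target_subset_range z
    (mem_extChartAt_target z)⟩
  have : ContractibleSpace C := ((convex_ball _ _).inter I.convex_range).contractibleSpace ⟨_, hzC⟩
  have hmem : ∀ u ∈ e.source ∩ e ⁻¹' Metric.ball (e z) ρ, e u ∈ C := fun u hu =>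
    ⟨hu.2, extChartAt_target_subset_range z (e.map_source hu.1)⟩
  have hg : Continuous fun w : C => e.symm w :=
    (continuousOn_extChartAt_symm z).comp_continuous continuous_subtype_val fun w => hsub w.2
  refine ⟨e.source ∩ e ⁻¹' Metric.ball (e z) ρ, ?_, ?_, fun x y p q hp hq => ?_⟩
  · exact (continuousOn_extChartAt z).isOpen_inter_preimage (isOpen_extChartAt_source z)
      Metric.isOpen_ball
  · exact ⟨mem_extChartAt_source z, Metric.mem_ball_self hρ⟩
  have hchart : ∀ r : Path x y, (∀ t, r t ∈ e.source ∩ e ⁻¹' Metric.ball (e z) ρ) →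
      ∃ r' : Path (⟨e x, hmem x (by simpa using hp 0)⟩ : C) ⟨e y, hmem y (by simpa using hp 1)⟩,
        ∀ t, e.symm (r' t : E) = r t := by
    refine fun r hr => ⟨⟨⟨fun t => ⟨e (r t), hmem _ (hr t)⟩, ?_⟩, ?_, ?_⟩, fun t =>
      e.left_inv (hr t).1⟩
    · exact ((continuousOn_extChartAt z).comp_continuous r.continuous
        fun t => (hr t).1).subtype_mk _
    · simp
    · simp
  obtain ⟨p', hp'⟩ := hchart p hp
  obtain ⟨q', hq'⟩ := hchart q hq
  exact homotopic_of_comp_eq hg p' q' hp' hq'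

theorem exists_forall_ball_subset_ball {M : Type*} [PseudoMetricSpace M] [CompactSpace M]
    {ρ : M → ℝ} (hρ : ∀ z, 0 < ρ z) : ∃ ε > 0, ∀ x, ∃ z, Metric.ball x ε ⊆ Metric.ball z (ρ z) := by
  obtain ⟨ε, hε, h⟩ := lebesgue_number_lemma_of_metric (isCompact_univ (X := M))
    (c := fun z => Metric.ball z (ρ z)) (fun _ => Metric.isOpen_ball)
    fun z _ => mem_iUnion.2 ⟨z, Metric.mem_ball_self (hρ z)⟩
  exact ⟨ε, hε, fun x => h x (mem_univ x)⟩

theorem exists_finset_forall_exists_dist_lt (M : Type*) [PseudoMetricSpace M] [CompactSpace M]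
    {ε : ℝ} (hε : 0 < ε) : ∃ Z : Finset M, ∀ x, ∃ z ∈ Z, dist x z < ε := by
  obtain ⟨Z, -, hZ⟩ := (isCompact_univ (X := M)).elim_nhds_subcover (fun z => Metric.ball z ε)
    fun z _ => Metric.ball_mem_nhds z hε
  exact ⟨Z, fun x => by simpa using hZ (mem_univ x)⟩

theorem IsSmall.mono {M : Type*} [MetricSpace M] {ε ε' : ℝ} (h : IsSmall M ε) (hε : ε' ≤ ε) :
    IsSmall M ε' := fun z _ _ p q hp hq =>
  h z _ _ p q (fun t => Metric.ball_subset_ball hε (hp t))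
    fun t => Metric.ball_subset_ball hε (hq t)

theorem exists_isSmall {E H : Type*} [NormedAddCommGroup E]
    [NormedSpace ℝ E] [TopologicalSpace H] (I : ModelWithCorners ℝ E H) (M : Type*)
    [MetricSpace M] [CompactSpace M] [ChartedSpace H M] : ∃ ε > 0, IsSmall M ε := by
  choose U hUo hzU hU using exists_isOpen_forall_homotopic I (M := M)
  choose ρ hρ hρU using fun z => Metric.isOpen_iff.1 (hUo z) z (hzU z)
  obtain ⟨ε, hε, h⟩ := exists_forall_ball_subset_ball hρ
  refine ⟨ε, hε, fun x _ _ p q hp hq => ?_⟩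
  obtain ⟨z, hz⟩ := h x
  exact hU z _ _ p q (fun t => hρU z (hz (hp t))) fun t => hρU z (hz (hq t))

section LocallyPathConnected

variable {M : Type*} [PseudoMetricSpace M] [LocallyPathConnectedSpace M]

theorem exists_forall_mem_ball_joinedIn (x : M) {η : ℝ} (hη : 0 < η) :
    ∃ ε > 0, ∀ y ∈ Metric.ball x ε, JoinedIn (Metric.ball x η) x y := by
  obtain ⟨V, ⟨hV, hVc⟩, hVs⟩ := (path_connected_basis x).mem_iff.1 (Metric.ball_mem_nhds x hη)
  obtain ⟨ε, hε, h⟩ := Metric.mem_nhds_iff.1 hV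
  exact ⟨ε, hε, fun y hy => (hVc.joinedIn x (mem_of_mem_nhds hV) y (h hy)).mono hVs⟩

theorem exists_forall_joinedIn_ball [CompactSpace M] {η : ℝ} (hη : 0 < η) :
    ∃ ε > 0, ∀ x y : M, dist x y < ε → JoinedIn (Metric.ball x η) x y := by
  choose ρ hρ h using fun x : M => exists_forall_mem_ball_joinedIn x (half_pos hη)
  obtain ⟨ε, hε, hL⟩ := exists_forall_ball_subset_ball
    (fun z => lt_min (hρ z) (half_pos hη))
  refine ⟨ε, hε, fun x y hxy => ?_⟩
  obtain ⟨z, hz⟩ := hL x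
  have hx := hz (Metric.mem_ball_self hε)
  have hy := hz (Metric.mem_ball'.2 hxy)
  have hsub : Metric.ball z (η / 2) ⊆ Metric.ball x η := by
    have hzx : dist z x < η / 2 := (Metric.mem_ball'.1 hx).trans_le (min_le_right _ _)
    exact Metric.ball_subset_ball' (by linarith)
  exact ((h z x (Metric.ball_subset_ball (min_le_left _ _) hx)).symm.trans
    (h z y (Metric.ball_subset_ball (min_le_left _ _) hy))).mono hsub

end LocallyPathConnected

/-! ### Cocycles along curves -/

section Chains

variable {X : Type*} [TopologicalSpace X]

/-- The restriction of `P` to the segment from `a` to `b`, parametrized by `[0,1]`. -/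
def seg (P : C(ℝ, X)) (a b : ℝ) : C(unitInterval, X) :=
  ⟨fun t => P (a + (b - a) * t), by fun_prop⟩

@[simp] theorem seg_apply (P : C(ℝ, X)) (a b : ℝ) (t : unitInterval) :
    seg P a b t = P (a + (b - a) * t) := rfl

theorem seg_zero (P : C(ℝ, X)) (a b : ℝ) : seg P a b 0 = P a := by simp

theorem seg_one (P : C(ℝ, X)) (a b : ℝ) : seg P a b 1 = P b := by simp

/-- The singular triangle `v ↦ P (k₀ v₀ + k₁ v₁ + k₂ v₂)`, a homology between the segments
of `P`. -/
def segTriangle (P : C(ℝ, X)) (k : Fin 3 → ℝ) : Simplex 2 X :=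
  ⟨fun v => P (∑ i, k i * v.1 i), by
    refine P.continuous.comp (continuous_finsetSum _ fun i _ => ?_)
    exact continuous_const.mul ((continuous_apply i).comp continuous_subtype_val)⟩

theorem face_segTriangle (P : C(ℝ, X)) (k : Fin 3 → ℝ) (i : Fin 3) :
    face (segTriangle P k) i = curveSimplex (seg P (k (i.succAbove 0)) (k (i.succAbove 1))) := by
  ext v
  change P (∑ j, k j * (faceMap 1 i v).1 j) =
    P (k (i.succAbove 0) + (k (i.succAbove 1) - k (i.succAbove 0)) *
      (stdSimplexHomeomorphUnitInterval v : ℝ))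
  congr 1
  have h := v.2.2
  rw [Fin.sum_univ_two] at h
  have h1 : (stdSimplexHomeomorphUnitInterval v : ℝ) = v.1 1 := rfl
  have h2 : ∀ j, (faceMap 1 i v).1 j =
      (if i.succAbove 0 = j then v.1 0 else 0) + (if i.succAbove 1 = j then v.1 1 else 0) := by
    intro j
    change stdSimplex.map _ v j = _
    rw [stdSimplex.map_coe, FunOnFinite.linearMap_apply_apply, Finset.sum_filter,
      Fin.sum_univ_two]
    rfl
  simp only [h1, h2, mul_add, Finset.sum_add_distrib, mul_ite, mul_zero, Finset.sum_ite_eq,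
    Finset.mem_univ, if_true]
  rw [show v.1 0 = 1 - v.1 1 by linarith]
  ring

variable (R : Type) [CommRing R]

theorem curveChain_seg_add (P : C(ℝ, X)) (a b e : ℝ) :
    curveChain R (seg P a b) + curveChain R (seg P b e) - curveChain R (seg P a e)
      ∈ LinearMap.range (boundary R X 1) := by
  refine ⟨single R (segTriangle P ![a, b, e]), ?_⟩
  have hb : boundary R X 1 (single R (segTriangle P ![a, b, e])) =
      ∑ i : Fin 3, ((-1 : ℤ) ^ (i : ℕ)) • single R (face (segTriangle P ![a, b, e]) i) :=
    extend_single R _ _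
  have h0 : face (segTriangle P ![a, b, e]) 0 = curveSimplex (seg P b e) := face_segTriangle P _ 0
  have h1 : face (segTriangle P ![a, b, e]) 1 = curveSimplex (seg P a e) := face_segTriangle P _ 1
  have h2 : face (segTriangle P ![a, b, e]) 2 = curveSimplex (seg P a b) := face_segTriangle P _ 2
  rw [hb, Fin.sum_univ_three, h0, h1, h2]
  simp only [curveChain, Fin.val_zero, Fin.val_one, Fin.val_two, pow_zero, pow_one, one_smul,
    neg_smul, even_two, Even.neg_pow, one_pow]
  abel

theorem curveChain_const (x : X) :
    curveChain R (ContinuousMap.const _ x) ∈ LinearMap.range (boundary R X 1) := by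
  have h := curveChain_seg_add R (ContinuousMap.const ℝ x) 0 0 0
  have e : seg (ContinuousMap.const ℝ x) 0 0 = ContinuousMap.const _ x := rfl
  rw [e] at h
  simpa using h

end Chains

section Cocycles

variable {X : Type*} [TopologicalSpace X]

/-- The value of a cocycle on a curve, i.e. the integral of the cocycle along the curve. -/
def curveValue (c : Cocycles X) (a : C(unitInterval, X)) : ℝ := c.1 (curveSimplex a)

theorem extend_eq_zero_of_mem_range (R : Type) [CommRing R] [Module R ℝ] (c : Cocycles X)
    {z : Chain R X 1} (hz : z ∈ LinearMap.range (boundary R X 1)) : extend R c.1 z = 0 := by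
  obtain ⟨w, rfl⟩ := hz
  rw [extend_boundary, show coboundary X 1 c.1 = 0 from c.2]
  exact LinearMap.congr_fun (chain_hom_ext R (f := extend R (0 : Simplex 2 X → ℝ)) (g := 0)
    fun σ => by simp) w

theorem extend_curveChain (R : Type) [CommRing R] [Module R ℝ] (c : Cocycles X)
    (a : C(unitInterval, X)) : extend R c.1 (curveChain R a) = curveValue c a :=
  extend_single R _ _

theorem curveValue_add_eq (c : Cocycles X) {a b e : C(unitInterval, X)}
    (h : curveChain ℤ a + curveChain ℤ b - curveChain ℤ e ∈ LinearMap.range (boundary ℤ X 1)) :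
    curveValue c a + curveValue c b = curveValue c e := by
  have := extend_eq_zero_of_mem_range ℤ c h
  rwa [map_sub, map_add, extend_curveChain, extend_curveChain, extend_curveChain,
    sub_eq_zero] at this

theorem curveValue_trans (c : Cocycles X) {x y z : X} (p : Path x y) (q : Path y z) :
    curveValue c (p.trans q).toContinuousMap =
      curveValue c p.toContinuousMap + curveValue c q.toContinuousMap :=
  (curveValue_add_eq c (curveChain_trans ℤ p q)).symm

theorem curveValue_seg_add (c : Cocycles X) (P : C(ℝ, X)) (a b e : ℝ) :
    curveValue c (seg P a b) + curveValue c (seg P b e) = curveValue c (seg P a e) :=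
  curveValue_add_eq c (curveChain_seg_add ℤ P a b e)

theorem curveValue_seg_self (c : Cocycles X) (P : C(ℝ, X)) (a : ℝ) :
    curveValue c (seg P a a) = 0 := by
  linarith [curveValue_seg_add c P a a a]

theorem seg_add_add {P : C(ℝ, X)} {l : ℝ} (hP : Function.Periodic P l) (a b : ℝ) :
    seg P (a + l) (b + l) = seg P a b := by
  ext t
  rw [seg_apply, seg_apply, ← hP (a + (b - a) * t)]
  congr 1
  ring

theorem curveValue_seg_add_period (c : Cocycles X) {P : C(ℝ, X)} {l : ℝ}
    (hP : Function.Periodic P l) (a : ℝ) :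
    curveValue c (seg P a (a + l)) = curveValue c (seg P 0 l) := by
  have hshift : seg P l (a + l) = seg P 0 a := by simpa using seg_add_add hP 0 a
  have h₁ := curveValue_seg_add c P a 0 (a + l)
  have h₂ := curveValue_seg_add c P 0 l (a + l)
  have h₃ := curveValue_seg_add c P a 0 a
  rw [hshift] at h₂
  rw [curveValue_seg_self] at h₃
  linarith

theorem curveValue_seg_add_nat_mul (c : Cocycles X) {P : C(ℝ, X)} {l : ℝ}
    (hP : Function.Periodic P l) (a : ℝ) (k : ℕ) :
    curveValue c (seg P a (a + k * l)) = k * curveValue c (seg P 0 l) := by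
  induction k with
  | zero => simp [curveValue_seg_self]
  | succ k ih =>
    have h := curveValue_seg_add c P a (a + k * l) (a + k * l + l)
    rw [ih, curveValue_seg_add_period c hP] at h
    push_cast
    rw [add_mul, one_mul, ← add_assoc, ← h]
    ring

theorem eval_loopClass (c : Cocycles X) (p : C(unitInterval, X)) (h : p 0 = p 1) :
    eval ℝ (Submodule.Quotient.mk c) (loopClass ℝ p h) = curveValue c p :=
  extend_curveChain ℝ c p

theorem eval_diff (c : Cocycles X) {x₀ : X} (p q : PathSpace x₀) (h : p.endpoint = q.endpoint) :
    eval ℤ (Submodule.Quotient.mk c) (p.diff q h) = curveValue c p.1 - curveValue c q.1 := by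
  have : eval ℤ (Submodule.Quotient.mk c) (p.diff q h) =
    extend ℤ c.1 (curveChain ℤ p.1 - curveChain ℤ q.1) := rfl
  rw [this, map_sub, extend_curveChain, extend_curveChain]

end Cocycles

/-! ### Lifting curves and flows to the coverings -/

theorem PathSpace.exists_endpoint {X : Type*} [TopologicalSpace X] [LocallyPathConnectedSpace X]
    [ConnectedSpace X] {x₀ : X} (x : X) : ∃ p : PathSpace x₀, p.endpoint = x := by
  have : PathConnectedSpace X := pathConnectedSpace_iff_connectedSpace.2 inferInstance
  obtain ⟨p⟩ := PathConnectedSpace.joined x₀ x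
  exact ⟨⟨p.toContinuousMap, p.source⟩, p.target⟩

namespace Cover

variable {X : Type*} [TopologicalSpace X] {x₀ : X} {K : Submodule ℤ (H1 ℤ X)}

theorem exists_mk (x : Cover x₀ K) : ∃ p : PathSpace x₀, mk K p = x := Quotient.exists_rep x

theorem mk_eq_mk {p q : PathSpace x₀} :
    mk K p = mk K q ↔ ∃ h : p.endpoint = q.endpoint, p.diff q h ∈ K :=
  Quotient.eq (r := coverSetoid x₀ K)

theorem continuous_mk : Continuous (mk K : PathSpace x₀ → Cover x₀ K) :=
  continuous_quotient_mk' (s := coverSetoid x₀ K)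

theorem continuous_proj : Continuous (proj : Cover x₀ K → X) := by
  refine Continuous.quotient_lift (s := coverSetoid x₀ K) ?_ _
  exact (continuous_eval_const (1 : unitInterval)).comp continuous_subtype_val

/-- `Link x a y` says that `y` is the end of the lift of the curve `a` that starts at `x`. It is
expressed by representatives of `x` and `y` so that it can be checked up to homology. -/
def Link (x : Cover x₀ K) (a : C(unitInterval, X)) (y : Cover x₀ K) : Prop :=
  ∃ p q : PathSpace x₀, mk K p = x ∧ mk K q = y ∧ p.endpoint = a 0 ∧ q.endpoint = a 1 ∧
    curveChain ℤ p.1 + curveChain ℤ a - curveChain ℤ q.1 ∈ LinearMap.range (boundary ℤ X 1)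

theorem diff_eq_diff {p q p' q' : PathSpace x₀} {a : C(unitInterval, X)}
    (h : curveChain ℤ p.1 + curveChain ℤ a - curveChain ℤ q.1 ∈ LinearMap.range (boundary ℤ X 1))
    (h' : curveChain ℤ p'.1 + curveChain ℤ a - curveChain ℤ q'.1
      ∈ LinearMap.range (boundary ℤ X 1)) (e : p.endpoint = p'.endpoint)
    (e' : q.endpoint = q'.endpoint) : q.diff q' e' = p.diff p' e := by
  refine (Submodule.Quotient.eq _).2 ?_
  change curveChain ℤ q.1 - curveChain ℤ q'.1 - (curveChain ℤ p.1 - curveChain ℤ p'.1)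
      ∈ LinearMap.range (boundary ℤ X 1)
  convert Submodule.sub_mem _ h' h using 1
  abel

theorem link_mk_append (p : PathSpace x₀) {y : X} (a : Path p.endpoint y) :
    Link (mk K p) a.toContinuousMap (mk K (p.append a)) :=
  ⟨p, p.append a, rfl, rfl, a.source.symm, by rw [PathSpace.endpoint_append]; exact a.target.symm,
    curveChain_trans ℤ p.toPath a⟩

namespace Link

theorem proj_left {x y : Cover x₀ K} {a : C(unitInterval, X)} (h : Link x a y) :
    x.proj = a 0 := by
  obtain ⟨p, q, rfl, rfl, h0, -, -⟩ := h
  exact h0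

theorem proj_right {x y : Cover x₀ K} {a : C(unitInterval, X)} (h : Link x a y) :
    y.proj = a 1 := by
  obtain ⟨p, q, rfl, rfl, -, h1, -⟩ := h
  exact h1

theorem exists_right (x : Cover x₀ K) (a : C(unitInterval, X)) (h : x.proj = a 0) :
    ∃ y, Link x a y := by
  obtain ⟨p, rfl⟩ := exists_mk x
  exact ⟨_, link_mk_append p (y := a 1) ⟨a, h.symm, rfl⟩⟩

theorem unique {x y y' : Cover x₀ K} {a : C(unitInterval, X)} (h : Link x a y)
    (h' : Link x a y') : y = y' := by
  obtain ⟨p, q, rfl, rfl, _, h1, hc⟩ := h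
  obtain ⟨p', q', hp, rfl, _, h1', hc'⟩ := h'
  obtain ⟨e, he⟩ := mk_eq_mk.1 hp.symm
  refine mk_eq_mk.2 ⟨h1.trans h1'.symm, ?_⟩
  rwa [diff_eq_diff hc hc' e]

theorem translate {x y x' y' : Cover x₀ K} {a : C(unitInterval, X)} (h : Link x a y)
    (h' : Link x' a y') : ∃ δ, IsTranslate δ x x' ∧ IsTranslate δ y y' := by
  obtain ⟨p, q, rfl, rfl, h0, h1, hc⟩ := h
  obtain ⟨p', q', rfl, rfl, h0', h1', hc'⟩ := h'
  exact ⟨p'.diff p (h0'.trans h0.symm), ⟨p, p', _, rfl, rfl, rfl⟩,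
    ⟨q, q', h1'.trans h1.symm, rfl, rfl, diff_eq_diff hc' hc _ _⟩⟩

theorem exists_right_mk {q : PathSpace x₀} {z : Cover x₀ K} {b : C(unitInterval, X)}
    (h : Link (mk K q) b z) : ∃ r : PathSpace x₀, mk K r = z ∧ r.endpoint = b 1 ∧
      curveChain ℤ q.1 + curveChain ℤ b - curveChain ℤ r.1 ∈ LinearMap.range (boundary ℤ X 1) := by
  let b' : Path q.endpoint (b 1) := ⟨b, h.proj_left.symm, rfl⟩
  exact ⟨q.append b', (link_mk_append q b').unique h, PathSpace.endpoint_append q b',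
    curveChain_trans ℤ q.toPath b'⟩

theorem comp {x y z : Cover x₀ K} {a b e : C(unitInterval, X)} (h : Link x a y)
    (h' : Link y b z) (h0 : e 0 = a 0) (h1 : e 1 = b 1)
    (he : curveChain ℤ a + curveChain ℤ b - curveChain ℤ e ∈ LinearMap.range (boundary ℤ X 1)) :
    Link x e z := by
  obtain ⟨p, q, rfl, rfl, hp, -, hc⟩ := h
  obtain ⟨r, rfl, hr, hc'⟩ := h'.exists_right_mk
  refine ⟨p, r, rfl, rfl, hp.trans h0.symm, hr.trans h1.symm, ?_⟩
  convert Submodule.add_mem _ (Submodule.sub_mem _ hc he) hc' using 1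
  abel

theorem of_comp {x y z : Cover x₀ K} {a b e : C(unitInterval, X)} (h : Link x a y)
    (h' : Link x e z) (h0 : b 0 = a 1) (h1 : b 1 = e 1)
    (he : curveChain ℤ a + curveChain ℤ b - curveChain ℤ e ∈ LinearMap.range (boundary ℤ X 1)) :
    Link y b z := by
  obtain ⟨w, hw⟩ := exists_right y b (h.proj_right.trans h0.symm)
  have hxw : Link x e w :=
    h.comp hw (h'.proj_left.symm.trans h.proj_left) h1.symm he
  rwa [h'.unique hxw]

theorem const (x : Cover x₀ K) : Link x (ContinuousMap.const _ x.proj) x := by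
  obtain ⟨p, rfl⟩ := exists_mk x
  exact ⟨p, p, rfl, rfl, rfl, rfl, by simpa using curveChain_const ℤ _⟩

end Link

/-- `B` is a lift to the covering of the curve `A`. -/
structure IsLift (A : C(ℝ, X)) (B : ℝ → Cover x₀ K) : Prop where
  continuous : Continuous B
  link : ∀ s s', Link (B s) (seg A s s') (B s')

theorem IsLift.proj {A : C(ℝ, X)} {B : ℝ → Cover x₀ K} (h : IsLift A B) (s : ℝ) :
    (B s).proj = A s :=
  (h.link s s).proj_left.trans (seg_zero A s s)

theorem exists_isLift (x : Cover x₀ K) (A : C(ℝ, X)) {s₀ : ℝ} (h : x.proj = A s₀) :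
    ∃ B : ℝ → Cover x₀ K, IsLift A B ∧ B s₀ = x := by
  obtain ⟨p, rfl⟩ := exists_mk x
  let a : ∀ s, Path p.endpoint (A s) := fun s =>
    ⟨seg A s₀ s, (seg_zero A s₀ s).trans h.symm, seg_one A s₀ s⟩
  have hB : ∀ s, Link (mk K p) (seg A s₀ s) (mk K (p.append (a s))) := fun s =>
    link_mk_append p (a s)
  refine ⟨fun s => mk K (p.append (a s)), ⟨?_, fun s s' => ?_⟩, ?_⟩
  · refine continuous_mk.comp (Continuous.subtype_mk
      (ContinuousMap.continuous_of_continuous_uncurry _ ?_) _)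
    refine Path.trans_continuous_family (fun _ => p.toPath)
      (p.toPath.continuous.comp continuous_snd) a ?_
    exact A.continuous.comp (by fun_prop : Continuous fun z : ℝ × unitInterval =>
      s₀ + (z.1 - s₀) * (z.2 : ℝ))
  · exact (hB s).of_comp (hB s') ((seg_zero A s s').trans (seg_one A s₀ s).symm)
      ((seg_one A s s').trans (seg_one A s₀ s').symm) (curveChain_seg_add ℤ A s₀ s s')
  · refine (hB s₀).unique ?_
    convert Link.const (mk K p) using 1
    ext t
    rw [seg_apply, sub_self, zero_mul, add_zero, ← h]
    rfl

/-- The orbit of `x`, as a curve parametrized by the time. -/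
def orbitCurve (φ : Flow ℝ X) (x : X) : C(ℝ, X) :=
  ⟨fun s => φ s x, φ.continuous continuous_id continuous_const⟩

theorem seg_orbitCurve (φ : Flow ℝ X) (x : X) (s t : ℝ) :
    seg (orbitCurve φ x) s (s + t) = (orbitArc φ t (φ s x)).toContinuousMap := by
  ext u
  change φ (s + (s + t - s) * u) x = φ (u * t) (φ s x)
  rw [← φ.map_add]
  congr 1
  ring

theorem link_liftFlow (φ : Flow ℝ X) (t : ℝ) (x : Cover x₀ K) :
    Link x (orbitArc φ t x.proj).toContinuousMap (liftFlow φ t x) := by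
  obtain ⟨p, rfl⟩ := exists_mk x
  exact link_mk_append p (orbitArc φ t p.endpoint)

@[simp] theorem proj_liftFlow (φ : Flow ℝ X) (t : ℝ) (x : Cover x₀ K) :
    (liftFlow φ t x).proj = φ t x.proj :=
  (link_liftFlow φ t x).proj_right.trans (orbitArc φ t x.proj).target

theorem liftFlow_zero (φ : Flow ℝ X) (x : Cover x₀ K) : liftFlow φ 0 x = x := by
  refine (link_liftFlow φ 0 x).unique ?_
  convert Link.const x using 1
  ext t
  change φ (t * 0) _ = x.proj
  rw [mul_zero, φ.map_zero_apply]

theorem isLift_liftFlow (φ : Flow ℝ X) (x : Cover x₀ K) :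
    IsLift (orbitCurve φ x.proj) fun s => liftFlow φ s x := by
  obtain ⟨B, hB, hB0⟩ := exists_isLift x (orbitCurve φ x.proj) (φ.map_zero_apply _).symm
  have hBφ : B = fun s => liftFlow φ s x := funext fun s => by
    have h := hB.link 0 s
    rw [hB0, ← zero_add s, seg_orbitCurve, φ.map_zero_apply, zero_add] at h
    exact h.unique (link_liftFlow φ s x)
  rwa [← hBφ]

theorem liftFlow_add (φ : Flow ℝ X) (s t : ℝ) (x : Cover x₀ K) :
    liftFlow φ (s + t) x = liftFlow φ t (liftFlow φ s x) := by
  have h := (isLift_liftFlow φ x).link s (s + t)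
  rw [seg_orbitCurve, ← proj_liftFlow] at h
  exact h.unique (link_liftFlow φ t (liftFlow φ s x))

/-- The value of the cocycle `c` on a curve that represents a point of the covering. When `c`
vanishes on `K` it does not depend on that curve, and it plays the role of a primitive of the
pull-back of `c` to the covering. -/
def primitive (c : Cocycles X) (x : Cover x₀ K) : ℝ := curveValue c (Quotient.out x).1

section Primitive

variable {c : Cocycles X}

theorem primitive_mk (hK : K ≤ intKer (Submodule.Quotient.mk c)) (p : PathSpace x₀) :
    primitive c (mk K p) = curveValue c p.1 := by
  have h : mk K (Quotient.out (mk K p)) = mk K p := Quotient.out_eq _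
  obtain ⟨e, he⟩ := mk_eq_mk.1 h
  have h0 : eval ℤ (Submodule.Quotient.mk c) (PathSpace.diff _ _ e) = 0 := hK he
  rw [eval_diff] at h0
  exact sub_eq_zero.1 h0

theorem Link.primitive_eq (hK : K ≤ intKer (Submodule.Quotient.mk c)) {x y : Cover x₀ K}
    {a : C(unitInterval, X)} (h : Link x a y) : primitive c y = primitive c x + curveValue c a := by
  obtain ⟨p, q, rfl, rfl, -, -, hc⟩ := h
  rw [primitive_mk hK, primitive_mk hK]
  exact (curveValue_add_eq c hc).symm

theorem isEquivariant_iff_sub_eq_sub (hK : K ≤ intKer (Submodule.Quotient.mk c))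
    {f : Cover x₀ K → ℝ} :
    IsEquivariant (Submodule.Quotient.mk c) f ↔
      ∀ x y : Cover x₀ K, x.proj = y.proj → f y - f x = primitive c y - primitive c x := by
  constructor
  · intro hf x y h
    obtain ⟨p, rfl⟩ := exists_mk x
    obtain ⟨q, rfl⟩ := exists_mk y
    have e : q.endpoint = p.endpoint := h.symm
    have := hf (q.diff p e) _ _ ⟨p, q, e, rfl, rfl, rfl⟩
    rw [this, eval_diff, primitive_mk hK, primitive_mk hK]
    ring
  · rintro hf δ x y ⟨p, q, h, rfl, rfl, rfl⟩
    have := hf (mk K p) (mk K q) h.symm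
    rw [eval_diff, ← primitive_mk hK, ← primitive_mk hK (K := K) p]
    linarith

theorem Link.sub_eq_sub (hK : K ≤ intKer (Submodule.Quotient.mk c)) {f : Cover x₀ K → ℝ}
    (hf : IsEquivariant (Submodule.Quotient.mk c) f) {x y x' y' : Cover x₀ K}
    {a : C(unitInterval, X)} (h : Link x a y) (h' : Link x' a y') : f y - f x = f y' - f x' := by
  have hf' := (isEquivariant_iff_sub_eq_sub hK).1 hf
  have h1 := hf' x x' (h.proj_left.trans h'.proj_left.symm)
  have h2 := hf' y y' (h.proj_right.trans h'.proj_right.symm)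
  have h3 := h.primitive_eq hK
  have h4 := h'.primitive_eq hK
  linarith

end Primitive

end Cover

/-! ### Small curves and equivariant functions on the coverings -/

/-- The curves from `y` to `z` that an `ε`-realization of a pseudo-orbit may follow at a time where
the pseudo-orbit jumps from `y` to `z`. When `y = z` there is no jump and the curve is constant. -/
structure IsJumpCurve {M : Type*} [MetricSpace M] (ε : ℝ) (b : C(unitInterval, M)) (y z : M) :
    Prop where
  source : b 0 = y
  target : b 1 = z
  mem_ball : ∀ t, b t ∈ Metric.ball z ε
  eq_of_eq : y = z → ∀ t, b t = z

theorem IsJumpCurve.const {M : Type*} [MetricSpace M] {ε : ℝ} (hε : 0 < ε) (y : M) :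
    IsJumpCurve ε (.const _ y) y y :=
  ⟨rfl, rfl, fun _ => Metric.mem_ball_self hε, fun _ _ => rfl⟩

namespace Cover

section SmallCurves

variable {M : Type*} [MetricSpace M] {x₀ : M} {K : Submodule ℤ (H1 ℤ M)}

theorem exists_forall_link_mem {x : Cover x₀ K} {U : Set (Cover x₀ K)} (hU : U ∈ 𝓝 x) :
    ∃ η > 0, ∀ (a : C(unitInterval, M)) (y : Cover x₀ K),
      (∀ t, a t ∈ Metric.ball x.proj η) → Link x a y → y ∈ U := by
  obtain ⟨p, rfl⟩ := exists_mk x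
  let q : PathSpace x₀ := p.append (Path.refl p.endpoint)
  have hq : mk K q = mk K p :=
    (link_mk_append p (Path.refl p.endpoint)).unique (Link.const (mk K p))
  have hU' : mk K ⁻¹' U ∈ 𝓝 q := continuous_mk.continuousAt (by rwa [hq])
  obtain ⟨η, hη, h⟩ := Metric.mem_nhds_iff.1 hU'
  refine ⟨η, hη, fun a y ha hy => ?_⟩
  let a' : Path p.endpoint (a 1) := ⟨a, hy.proj_left.symm, rfl⟩
  rw [← (link_mk_append p a').unique hy]
  refine h ?_
  rw [Metric.mem_ball, Subtype.dist_eq]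
  refine (ContinuousMap.dist_lt_iff hη).2 fun t => ?_
  change dist ((p.toPath.trans a') t) ((p.toPath.trans (Path.refl _)) t) < η
  rw [Path.trans_apply, Path.trans_apply]
  split_ifs
  · simpa using hη
  · exact ha _

variable [CompactSpace M] [LocallyPathConnectedSpace M] [ConnectedSpace M]

/- The point `y` is reached from a lift of the centre `z` of a fixed ball, going first to `x` along
the lift of a curve `b` and then along the lift of `a`. -/
theorem exists_forall_link_lt_of_eventually_lt {D : Cover x₀ K → Cover x₀ K → ℝ}
    (hlink : ∀ {x y x' y' : Cover x₀ K} {a : C(unitInterval, M)},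
      Link x a y → Link x' a y' → D x' y' = D x y)
    (htriangle : ∀ x y z, D y z ≤ D x y + D x z)
    (hnhds : ∀ x, ∀ r > 0, ∀ᶠ y in 𝓝 x, D x y < r) {r : ℝ} (hr : 0 < r) :
    ∃ ε > 0, ∀ (z : M) (a : C(unitInterval, M)) (x y : Cover x₀ K),
      (∀ t, a t ∈ Metric.ball z ε) → Link x a y → D x y < r := by
  have hsurj : ∀ z : M, ∃ x : Cover x₀ K, x.proj = z := fun z =>
    (PathSpace.exists_endpoint z).imp' (mk K) fun _ hp => hp
  choose s hs using hsurj
  choose η hη hD using fun z => exists_forall_link_mem (hnhds (s z) _ (half_pos hr))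
  choose ρ hρ hjoin using fun z : M => exists_forall_mem_ball_joinedIn z (hη z)
  obtain ⟨ε, hε, hball⟩ := exists_forall_ball_subset_ball fun z => lt_min (hρ z) (hη z)
  refine ⟨ε, hε, fun z₀ a x y ha hxy => ?_⟩
  obtain ⟨z, hz⟩ := hball z₀
  obtain ⟨b, hb⟩ := hjoin z (a 0) (Metric.ball_subset_ball (min_le_left _ _) (hz (ha 0)))
  have haz : ∀ t, a t ∈ Metric.ball z (η z) := fun t =>
    Metric.ball_subset_ball (min_le_right _ _) (hz (ha t))
  let a' : Path (a 0) (a 1) := ⟨a, rfl, rfl⟩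
  obtain ⟨x', hx'⟩ := Link.exists_right (s z) b.toContinuousMap ((hs z).trans b.source.symm)
  obtain ⟨y', hy'⟩ := Link.exists_right x' a (hx'.proj_right.trans b.target)
  have hby' : Link (s z) (b.trans a').toContinuousMap y' :=
    hx'.comp hy' ((b.trans a').source.trans b.source.symm) (b.trans a').target
      (curveChain_trans ℤ b a')
  have hx'r : D (s z) x' < r / 2 := hD z _ x' (fun t => by rw [hs z]; exact hb t) hx'
  have hy'r : D (s z) y' < r / 2 := by
    refine hD z _ y' (fun t => ?_) hby'
    change (b.trans a') t ∈ _
    rw [hs z, Path.trans_apply]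
    split_ifs
    · exact hb _
    · exact haz _
  calc D x y = D x' y' := hlink hy' hxy
    _ ≤ D (s z) x' + D (s z) y' := htriangle _ _ _
    _ < r := by linarith

end SmallCurves

end Cover

namespace IsLiftedMetric

open Cover

section Metric

variable {M : Type*} [MetricSpace M] {x₀ : M} {K : Submodule ℤ (H1 ℤ M)}
  {d : Cover x₀ K → Cover x₀ K → ℝ}

theorem self (hd : IsLiftedMetric d) (x : Cover x₀ K) : d x x = 0 := (hd.eq_zero_iff x x).2 rfl

theorem nonneg (hd : IsLiftedMetric d) (x y : Cover x₀ K) : 0 ≤ d x y := by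
  have h := hd.triangle x y x
  rw [hd.self, hd.symm y x] at h
  linarith

theorem isOpen_ball (hd : IsLiftedMetric d) (x : Cover x₀ K) (r : ℝ) : IsOpen {y | d x y < r} := by
  refine (hd.isOpen_iff _).2 fun y hy => ⟨r - d x y, sub_pos.2 hy, fun z hz => ?_⟩
  have := hd.triangle x y z
  change d x z < r
  linarith

theorem eventually_lt (hd : IsLiftedMetric d) (x : Cover x₀ K) {r : ℝ} (hr : 0 < r) :
    ∀ᶠ y in 𝓝 x, d x y < r :=
  (hd.isOpen_ball x r).mem_nhds (by simpa [hd.self] using hr)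

theorem t2Space (hd : IsLiftedMetric d) : T2Space (Cover x₀ K) := by
  refine ⟨fun x y hxy => ?_⟩
  have hpos : 0 < d x y := (hd.nonneg x y).lt_of_ne fun h => hxy ((hd.eq_zero_iff x y).1 h.symm)
  refine ⟨_, _, hd.isOpen_ball x (d x y / 2), hd.isOpen_ball y (d x y / 2), ?_, ?_, ?_⟩
  · simpa [hd.self] using hpos
  · simpa [hd.self] using hpos
  · refine disjoint_left.2 fun z (hxz : d x z < _) (hyz : d y z < _) => ?_
    have := hd.triangle x z y
    rw [hd.symm z y] at this
    linarith

theorem eq_of_link (hd : IsLiftedMetric d) {x y x' y' : Cover x₀ K}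
    {a : C(unitInterval, M)} (h : Link x a y) (h' : Link x' a y') : d x' y' = d x y := by
  obtain ⟨δ, hx, hy⟩ := h.translate h'
  exact hd.deck_invariant δ x y x' y' hx hy

theorem exists_forall_dist_proj_eq (hd : IsLiftedMetric d) :
    ∃ r > 0, ∀ x y : Cover x₀ K, d x y < r → dist x.proj y.proj = d x y := by
  obtain ⟨r, hr, h⟩ := hd.isometry_on_balls
  exact ⟨r, hr, fun x y hxy => h x x y (by rwa [hd.self]) hxy⟩

theorem exists_forall_eq_of_proj_eq (hd : IsLiftedMetric d) :
    ∃ r > 0, ∀ x y : Cover x₀ K, d x y < r → x.proj = y.proj → x = y := by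
  obtain ⟨r, hr, h⟩ := hd.exists_forall_dist_proj_eq
  refine ⟨r, hr, fun x y hxy hproj => (hd.eq_zero_iff x y).1 ?_⟩
  rw [← h x y hxy, hproj, dist_self]

end Metric

section Compact

variable {M : Type*} [MetricSpace M] [CompactSpace M] [LocallyPathConnectedSpace M]
  [ConnectedSpace M] {x₀ : M} {K : Submodule ℤ (H1 ℤ M)} {d : Cover x₀ K → Cover x₀ K → ℝ}

theorem exists_forall_link_lt (hd : IsLiftedMetric d) {r : ℝ} (hr : 0 < r) :
    ∃ ε > 0, ∀ (z : M) (a : C(unitInterval, M)) (x y : Cover x₀ K),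
      (∀ t, a t ∈ Metric.ball z ε) → Link x a y → d x y < r :=
  exists_forall_link_lt_of_eventually_lt hd.eq_of_link
    (fun x y z => by simpa only [hd.symm y x] using hd.triangle y x z)
    (fun x _ hr => hd.eventually_lt x hr) hr

theorem exists_forall_exists_link (hd : IsLiftedMetric d) {η : ℝ} (hη : 0 < η) :
    ∃ ε > 0, ∀ x y : Cover x₀ K, d x y < ε → ∃ a, IsJumpCurve η a x.proj y.proj ∧ Link x a y := by
  obtain ⟨r, hr, hisom⟩ := hd.exists_forall_dist_proj_eq
  obtain ⟨r', hr', hinj⟩ := hd.exists_forall_eq_of_proj_eq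
  obtain ⟨ε₁, hε₁, hlink⟩ := hd.exists_forall_link_lt (half_pos hr')
  obtain ⟨ε₂, hε₂, hjoin⟩ := exists_forall_joinedIn_ball (M := M) (lt_min hη hε₁)
  refine ⟨min (min r ε₂) (r' / 2), by positivity, fun x y hxy => ?_⟩
  simp only [lt_min_iff] at hxy
  obtain ⟨⟨hxyr, hxyε⟩, hxyr'⟩ := hxy
  by_cases hproj : x.proj = y.proj
  · obtain rfl := hinj x y (by linarith) hproj
    exact ⟨_, .const hη _, Link.const x⟩
  · obtain ⟨a, ha⟩ := (hjoin y.proj x.proj (by rwa [dist_comm, hisom x y hxyr])).symm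
    obtain ⟨y', hy'⟩ := Link.exists_right x a.toContinuousMap a.source.symm
    have hxy' : d x y' < r' / 2 := hlink y.proj a.toContinuousMap x y'
      (fun t => Metric.ball_subset_ball (min_le_right _ _) (ha t)) hy'
    have hyy' := hd.triangle y' x y
    rw [hd.symm y' x] at hyy'
    obtain rfl := hinj y' y (by linarith) (hy'.proj_right.trans a.target)
    exact ⟨a.toContinuousMap, ⟨a.source, a.target,
      fun t => Metric.ball_subset_ball (min_le_left _ _) (ha t), fun h => absurd h hproj⟩, hy'⟩

variable {c : Cocycles M}

theorem exists_forall_abs_sub_lt (hd : IsLiftedMetric d)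
    (hK : K ≤ intKer (Submodule.Quotient.mk c)) {f : Cover x₀ K → ℝ} (hfc : Continuous f)
    (hf : IsEquivariant (Submodule.Quotient.mk c) f) {r : ℝ} (hr : 0 < r) :
    ∃ ρ > 0, ∀ x y : Cover x₀ K, d x y < ρ → |f y - f x| < r := by
  obtain ⟨ε, hε, hsmall⟩ := exists_forall_link_lt_of_eventually_lt
    (D := fun x y => |f y - f x|) (fun h h' => congrArg abs (h'.sub_eq_sub hK hf h))
    (fun x y z => by
      simpa only [abs_sub_comm (f y), add_comm] using abs_sub_le (f z) (f x) (f y))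
    (fun x r hr => Metric.continuousAt_iff'.1 hfc.continuousAt r hr) hr
  obtain ⟨ρ, hρ, hlink⟩ := hd.exists_forall_exists_link hε
  refine ⟨ρ, hρ, fun x y hxy => ?_⟩
  obtain ⟨a, ha, hxay⟩ := hlink x y hxy
  exact hsmall y.proj a x y ha.mem_ball hxay

end Compact

end IsLiftedMetric

section FlowVariation

variable {M : Type*} [MetricSpace M] [CompactSpace M]

theorem exists_forall_dist_flow_lt (φ : Flow ℝ M) {ε : ℝ} (hε : 0 < ε) :
    ∃ κ > 0, ∀ s, |s| < κ → ∀ m, dist (φ s m) m < ε := by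
  have hev : ∀ᶠ s in 𝓝 (0 : ℝ), ∀ m ∈ (univ : Set M), dist (φ s m) m < ε := by
    refine isCompact_univ.eventually_forall_of_forall_eventually fun m _ => ?_
    have hcont : Continuous fun z : ℝ × M => dist (φ z.1 z.2) z.2 :=
      (φ.continuous continuous_fst continuous_snd).dist continuous_snd
    refine (hcont.tendsto (0, m)).eventually (gt_mem_nhds ?_)
    simpa [φ.map_zero_apply] using hε
  obtain ⟨κ, hκ, h⟩ := Metric.eventually_nhds_iff.1 hev
  exact ⟨κ, hκ, fun s hs m => h (by rwa [Real.dist_0_eq_abs]) m (mem_univ m)⟩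

variable [LocallyPathConnectedSpace M] [ConnectedSpace M] {x₀ : M} {K : Submodule ℤ (H1 ℤ M)}
  {d : Cover x₀ K → Cover x₀ K → ℝ} {c : Cocycles M}

open Cover

theorem exists_forall_apply_liftFlow_le_add_one (hd : IsLiftedMetric d)
    (hK : K ≤ intKer (Submodule.Quotient.mk c)) {f : Cover x₀ K → ℝ} (hfc : Continuous f)
    (hf : IsEquivariant (Submodule.Quotient.mk c) f) (φ : Flow ℝ M) :
    ∃ κ > 0, ∀ x : Cover x₀ K, ∀ s, |s| < κ → f (liftFlow φ s x) ≤ f x + 1 := by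
  obtain ⟨ρ, hρ, hfρ⟩ := hd.exists_forall_abs_sub_lt hK hfc hf one_pos
  obtain ⟨ε, hε, hlink⟩ := hd.exists_forall_link_lt hρ
  obtain ⟨κ, hκ, hφ⟩ := exists_forall_dist_flow_lt φ hε
  refine ⟨κ, hκ, fun x s hs => ?_⟩
  have hd_lt : d x (liftFlow φ s x) < ρ := by
    refine hlink x.proj _ _ _ (fun t => hφ (t * s) ?_ _) (link_liftFlow φ s x)
    rw [abs_mul, abs_of_nonneg t.2.1]
    exact (mul_le_of_le_one_left (abs_nonneg s) t.2.2).trans_lt hs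
  linarith [(abs_lt.1 (hfρ _ _ hd_lt)).2]

theorem exists_forall_apply_liftFlow_le_add (hd : IsLiftedMetric d)
    (hK : K ≤ intKer (Submodule.Quotient.mk c)) {f : Cover x₀ K → ℝ} (hfc : Continuous f)
    (hf : IsEquivariant (Submodule.Quotient.mk c) f) (φ : Flow ℝ M) (S : ℝ) :
    ∃ C ≥ 0, ∀ x : Cover x₀ K, ∀ s ∈ Icc 0 S, f (liftFlow φ s x) ≤ f x + C := by
  obtain ⟨κ, hκ, hstep⟩ := exists_forall_apply_liftFlow_le_add_one hd hK hfc hf φ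
  have hiterate : ∀ x : Cover x₀ K, ∀ s, |s| < κ → ∀ n : ℕ,
      f (liftFlow φ (n * s) x) ≤ f x + n := by
    intro x s hs n
    induction n with
    | zero => simp [liftFlow_zero]
    | succ n ih =>
      rw [Nat.cast_succ, add_one_mul, liftFlow_add]
      linarith [hstep (liftFlow φ (n * s) x) s hs]
  obtain ⟨n, hn⟩ := exists_nat_gt (S / κ)
  refine ⟨n + 1, by positivity, fun x s hs => ?_⟩
  have hn' : S < (n + 1) * κ := by
    rw [div_lt_iff₀ hκ] at hn
    linarith
  have hsmall : |s / (n + 1)| < κ := by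
    rw [abs_of_nonneg (div_nonneg hs.1 (by positivity)), div_lt_iff₀ (by positivity)]
    linarith [hs.2]
  have h := hiterate x _ hsmall (n + 1)
  rwa [Nat.cast_succ, mul_div_cancel₀ _ (by positivity)] at h

end FlowVariation

section ExistsEquivariant

variable {M : Type*} [MetricSpace M] [CompactSpace M] {x₀ : M} {K : Submodule ℤ (H1 ℤ M)}
  {d : Cover x₀ K → Cover x₀ K → ℝ} {c : Cocycles M}

open Cover

theorem exists_forall_exists_isEquivariant_continuousAt [LocallyPathConnectedSpace M]
    [ConnectedSpace M] (hd : IsLiftedMetric d) (hK : K ≤ intKer (Submodule.Quotient.mk c)) :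
    ∃ ρ > 0, ∀ z : M, ∃ g : Cover x₀ K → ℝ, IsEquivariant (Submodule.Quotient.mk c) g ∧
      ∀ x : Cover x₀ K, dist x.proj z < ρ → ContinuousAt g x := by
  obtain ⟨r, hr, hinj⟩ := hd.exists_forall_eq_of_proj_eq
  have hr3 : 0 < r / 3 := by positivity
  obtain ⟨ε, hε, hlink⟩ := hd.exists_forall_link_lt hr3
  obtain ⟨ρ, hρ, hjoin⟩ := exists_forall_joinedIn_ball (M := M) hε
  refine ⟨ρ, hρ, fun z => ?_⟩
  have hcurve : ∀ m : M, ∃ a : C(unitInterval, M), dist m z < ρ →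
      a 0 = m ∧ a 1 = z ∧ ∀ t, a t ∈ Metric.ball m ε := by
    intro m
    by_cases hm : dist m z < ρ
    · obtain ⟨a, ha⟩ := hjoin m z hm
      exact ⟨a.toContinuousMap, fun _ => ⟨a.source, a.target, ha⟩⟩
    · exact ⟨ContinuousMap.const _ z, fun h => absurd h hm⟩
  choose a ha using hcurve
  -- Near `z`, this is the primitive at the point over `z` that is close to `x`.
  let g : Cover x₀ K → ℝ := fun x => primitive c x + curveValue c (a x.proj)
  have hg : ∀ x : Cover x₀ K, dist x.proj z < ρ →
      ∃ y : Cover x₀ K, y.proj = z ∧ d x y < r / 3 ∧ g x = primitive c y := by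
    intro x hx
    obtain ⟨h0, h1, hball⟩ := ha x.proj hx
    obtain ⟨y, hy⟩ := Link.exists_right x (a x.proj) h0.symm
    exact ⟨y, hy.proj_right.trans h1, hlink _ _ _ _ hball hy, (hy.primitive_eq hK).symm⟩
  refine ⟨g, (isEquivariant_iff_sub_eq_sub hK).2 fun x y h => ?_, fun x hx => ?_⟩
  · simp only [g, h, add_sub_add_right_eq_sub]
  · refine (continuousAt_const (y := g x)).congr ?_
    have hproj : ∀ᶠ x' : Cover x₀ K in 𝓝 x, dist x'.proj z < ρ :=
      (continuous_proj.dist continuous_const).continuousAt.eventually (gt_mem_nhds hx)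
    filter_upwards [hd.eventually_lt x hr3, hproj] with x' hxx' hx'
    obtain ⟨y, hyz, hxy, hgx⟩ := hg x hx
    obtain ⟨y', hyz', hxy', hgx'⟩ := hg x' hx'
    have hyy' : d y y' < r := by
      have h1 := hd.triangle y x y'
      have h2 := hd.triangle x x' y'
      rw [hd.symm y x] at h1
      linarith
    rw [hgx, hgx', hinj y y' hyy' (hyz.trans hyz'.symm)]

theorem exists_continuous_isEquivariant_of_continuousAt
    (hK : K ≤ intKer (Submodule.Quotient.mk c)) {ρ : ℝ} (hρ : 0 < ρ) {g : M → Cover x₀ K → ℝ}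
    (hg : ∀ z, IsEquivariant (Submodule.Quotient.mk c) (g z))
    (hgc : ∀ z (x : Cover x₀ K), dist x.proj z < ρ → ContinuousAt (g z) x) :
    ∃ f : Cover x₀ K → ℝ, Continuous f ∧ IsEquivariant (Submodule.Quotient.mk c) f := by
  obtain ⟨Z, hZ⟩ := exists_finset_forall_exists_dist_lt M (half_pos hρ)
  let w : M → M → ℝ := fun z m => max 0 (ρ / 2 - dist m z)
  have hw : ∀ z, Continuous (w z) := fun z => by fun_prop
  have hpos : ∀ m, 0 < ∑ z ∈ Z, w z m := fun m => by
    obtain ⟨z, hz, hmz⟩ := hZ m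
    exact Finset.sum_pos' (fun _ _ => le_max_left _ _) ⟨z, hz, lt_max_of_lt_right (sub_pos.2 hmz)⟩
  refine ⟨fun x => (∑ z ∈ Z, w z x.proj * g z x) / ∑ z ∈ Z, w z x.proj, ?_, ?_⟩
  · refine Continuous.div ?_ ((continuous_finsetSum _ fun z _ => hw z).comp continuous_proj)
      fun x => (hpos _).ne'
    refine continuous_finsetSum _ fun z _ => continuous_iff_continuousAt.2 fun x => ?_
    rcases lt_or_ge (dist x.proj z) ρ with hx | hx
    · exact ((hw z).comp continuous_proj).continuousAt.mul (hgc z x hx)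
    · have hfar : ∀ᶠ x' : Cover x₀ K in 𝓝 x, ρ / 2 < dist x'.proj z :=
        (continuous_proj.dist continuous_const).continuousAt.eventually
          (lt_mem_nhds (by linarith))
      refine (continuousAt_const (y := (0 : ℝ))).congr ?_
      filter_upwards [hfar] with x' hx'
      rw [show w z x'.proj = 0 from max_eq_left (by linarith), zero_mul]
  · refine (isEquivariant_iff_sub_eq_sub hK).2 fun x y h => ?_
    have hgz : ∀ z, g z y - g z x = primitive c y - primitive c x := fun z =>
      (isEquivariant_iff_sub_eq_sub hK).1 (hg z) x y h
    simp only [← h]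
    rw [← sub_div, ← Finset.sum_sub_distrib, div_eq_iff (hpos _).ne', Finset.mul_sum]
    exact Finset.sum_congr rfl fun z _ => by rw [← mul_sub, hgz, mul_comm]

theorem exists_continuous_isEquivariant [LocallyPathConnectedSpace M] [ConnectedSpace M]
    (hd : IsLiftedMetric d) (hK : K ≤ intKer (Submodule.Quotient.mk c)) :
    ∃ f : Cover x₀ K → ℝ, Continuous f ∧ IsEquivariant (Submodule.Quotient.mk c) f := by
  obtain ⟨ρ, hρ, h⟩ := exists_forall_exists_isEquivariant_continuousAt hd hK
  choose g hg hgc using h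
  exact exists_continuous_isEquivariant_of_continuousAt hK hρ hg hgc

end ExistsEquivariant

/-! ### Pseudo-orbits made of orbit arcs -/

section OrbitArcs

theorem eq_flow_of_eventually_eq {N : Type*} [TopologicalSpace N] [T2Space N] {ψ : ℝ → N → N}
    (hadd : ∀ s t x, ψ (s + t) x = ψ t (ψ s x)) (h0 : ∀ x, ψ 0 x = x)
    (hc : ∀ x, Continuous fun t => ψ t x) {γ : ℝ → N} {a b : ℝ} (hab : a ≤ b)
    (hloc : ∀ t ∈ Ico a b, ∀ᶠ s in 𝓝[>] t, γ s = ψ (s - t) (γ t))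
    (hγ : ContinuousOn γ (Icc a b)) : γ b = ψ (b - a) (γ a) := by
  have hψ : Continuous fun t => ψ (t - a) (γ a) := (hc (γ a)).comp (by fun_prop)
  have hclosed : IsClosed ({t | γ t = ψ (t - a) (γ a)} ∩ Icc a b) := by
    rw [inter_comm]
    exact (hγ.prodMk hψ.continuousOn).preimage_isClosed_of_isClosed isClosed_Icc isClosed_diagonal
  refine hclosed.Icc_subset_of_forall_mem_nhdsWithin (by simp [h0]) ?_ (right_mem_Icc.2 hab)
  rintro t ⟨ht, hts⟩
  filter_upwards [hloc t hts] with s hs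
  rw [hs, show γ t = _ from ht, ← hadd]
  congr 1
  ring

theorem finite_of_spacing {S : Set ℝ} {a b T : ℝ} (hT : 0 < T) (hS : S ⊆ Icc a b)
    (h : ∀ u ∈ S, ∀ v ∈ S, u < v → T ≤ v - u) : S.Finite := by
  have hfloor : ∀ u ∈ S, ∀ v ∈ S, u < v → ⌊u / T⌋ ≠ ⌊v / T⌋ := by
    intro u hu v hv huv he
    have h1 := Int.abs_sub_lt_one_of_floor_eq_floor he.symm
    rw [← sub_div, abs_of_pos (div_pos (sub_pos.2 huv) hT), div_lt_one hT] at h1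
    linarith [h u hu v hv huv]
  refine Finite.of_finite_image (f := fun u => ⌊u / T⌋)
    ((finite_Icc ⌊a / T⌋ ⌊b / T⌋).subset ?_) fun u hu v hv he => ?_
  · rintro _ ⟨u, hu, rfl⟩
    obtain ⟨hau, hub⟩ := hS hu
    constructor <;> dsimp only <;> gcongr
  · by_contra hne
    rcases lt_or_gt_of_ne hne with huv | hvu
    · exact hfloor u hu v hv huv he
    · exact hfloor v hv u hu hvu he.symm

theorem exists_mem_Ico_of_spacing {τ : ℤ → ℝ} {T : ℝ} (hT : 0 < T)
    (hτ : ∀ k, T ≤ τ (k + 1) - τ k) (r : ℝ) : ∃ k, r ∈ Ico (τ k) (τ (k + 1)) := by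
  have hmono : Monotone fun k : ℤ => τ k - k * T := monotone_int_of_le_succ fun k => by
    push_cast
    linarith [hτ k]
  set q : ℤ := ⌊(r - τ 0) / T⌋
  have hbdd : ∀ k, τ k ≤ r → k ≤ max 0 q := by
    intro k hk
    rcases le_total k 0 with h | h
    · exact le_max_of_le_left h
    · refine le_max_of_le_right (Int.le_floor.2 ((le_div_iff₀ hT).2 ?_))
      have := hmono h
      simp only [Int.cast_zero, zero_mul, sub_zero] at this
      linarith
  have hnonempty : τ (min 0 q) ≤ r := by
    have h1 : (q : ℝ) * T ≤ r - τ 0 := (le_div_iff₀ hT).1 (Int.floor_le _)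
    have h2 : ((min 0 q : ℤ) : ℝ) * T ≤ q * T :=
      mul_le_mul_of_nonneg_right (Int.cast_le.2 (min_le_right _ _)) hT.le
    have := hmono (min_le_left 0 q)
    simp only [Int.cast_zero, zero_mul, sub_zero] at this
    linarith
  obtain ⟨k, hk, hmax⟩ := Int.exists_greatest_of_bdd (P := fun k => τ k ≤ r) ⟨_, hbdd⟩
    ⟨_, hnonempty⟩
  exact ⟨k, hk, lt_of_not_ge fun h => by have := hmax _ h; lia⟩

variable {M : Type*} [MetricSpace M]

/-- The concatenation of the orbit arcs that leave `x k` at time `τ k` and last until time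
`τ (k + 1)`. The arc used at time `r` is the one with `r ∈ [τ k, τ (k + 1)[`, which is unique when
`τ` is monotone. -/
def piecewiseOrbit (φ : Flow ℝ M) (τ : ℤ → ℝ) (x : ℤ → M) (r : ℝ) : M :=
  let k := Classical.epsilon fun k => r ∈ Ico (τ k) (τ (k + 1))
  φ (r - τ k) (x k)

variable {φ : Flow ℝ M} {τ : ℤ → ℝ} {x : ℤ → M} {T ε r : ℝ} {k : ℤ}

theorem continuous_flow_sub (φ : Flow ℝ M) (a : ℝ) (y : M) : Continuous fun r => φ (r - a) y :=
  φ.continuous (by fun_prop) continuous_const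

theorem piecewiseOrbit_of_mem_Ico (hτ : Monotone τ) (h : r ∈ Ico (τ k) (τ (k + 1))) :
    piecewiseOrbit φ τ x r = φ (r - τ k) (x k) := by
  have hk : Classical.epsilon (fun j => r ∈ Ico (τ j) (τ (j + 1))) = k :=
    hτ.pairwise_disjoint_on_Ico_succ.eq
      (not_disjoint_iff.2 ⟨r, Classical.epsilon_spec (p := fun j => r ∈ Ico (τ j) (τ (j + 1)))
        ⟨k, h⟩, h⟩)
  simp only [piecewiseOrbit, hk]

theorem piecewiseOrbit_mark (hτ : StrictMono τ) (k : ℤ) : piecewiseOrbit φ τ x (τ k) = x k := by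
  rw [piecewiseOrbit_of_mem_Ico hτ.monotone (left_mem_Ico.2 (hτ (lt_add_one k))), sub_self,
    φ.map_zero_apply]

theorem eventually_piecewiseOrbit_eq (hτ : Monotone τ) (h : r ∈ Ico (τ k) (τ (k + 1))) :
    ∀ᶠ s in 𝓝[≥] r, piecewiseOrbit φ τ x s = φ (s - r) (piecewiseOrbit φ τ x r) := by
  filter_upwards [Ico_mem_nhdsGE h.2] with s hs
  rw [piecewiseOrbit_of_mem_Ico hτ h, piecewiseOrbit_of_mem_Ico hτ ⟨h.1.trans hs.1, hs.2⟩,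
    ← φ.map_add]
  congr 1
  ring

theorem continuousAt_piecewiseOrbit (hτ : Monotone τ) (h : r ∈ Ioo (τ k) (τ (k + 1))) :
    ContinuousAt (piecewiseOrbit φ τ x) r := by
  refine (continuous_flow_sub φ (τ k) (x k)).continuousAt.congr ?_
  filter_upwards [Ioo_mem_nhds h.1 h.2] with s hs
  exact (piecewiseOrbit_of_mem_Ico hτ (Ioo_subset_Ico_self hs)).symm

theorem tendsto_piecewiseOrbit_nhdsLT (hτ : StrictMono τ) (k : ℤ) :
    Tendsto (piecewiseOrbit φ τ x) (𝓝[<] τ (k + 1)) (𝓝 (φ (τ (k + 1) - τ k) (x k))) := by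
  refine ((continuous_flow_sub φ (τ k) (x k)).continuousAt.mono_left nhdsWithin_le_nhds).congr' ?_
  filter_upwards [Ioo_mem_nhdsLT (hτ (lt_add_one k))] with s hs
  exact (piecewiseOrbit_of_mem_Ico hτ.monotone (Ioo_subset_Ico_self hs)).symm

theorem flow_eq_of_continuousAt_piecewiseOrbit (hτ : StrictMono τ)
    (h : ContinuousAt (piecewiseOrbit φ τ x) (τ (k + 1))) :
    φ (τ (k + 1) - τ k) (x k) = x (k + 1) := by
  rw [← tendsto_nhds_unique (h.mono_left nhdsWithin_le_nhds) (tendsto_piecewiseOrbit_nhdsLT hτ k),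
    piecewiseOrbit_mark hτ]

theorem strictMono_of_spacing (hT : 0 < T) (hτ : ∀ k, T ≤ τ (k + 1) - τ k) : StrictMono τ :=
  strictMono_int_of_lt_succ fun k => by linarith [hτ k]

theorem exists_eq_of_not_continuousAt_piecewiseOrbit (hT : 0 < T)
    (hτ : ∀ k, T ≤ τ (k + 1) - τ k) (hr : ¬ ContinuousAt (piecewiseOrbit φ τ x) r) :
    ∃ k, r = τ (k + 1) := by
  obtain ⟨k, hk⟩ := exists_mem_Ico_of_spacing hT hτ r
  rcases hk.1.eq_or_lt with h | h
  · exact ⟨k - 1, by rw [sub_add_cancel, h]⟩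
  · exact absurd (continuousAt_piecewiseOrbit (strictMono_of_spacing hT hτ).monotone ⟨h, hk.2⟩) hr

theorem periodic_piecewiseOrbit (hT : 0 < T) (hτ : ∀ k, T ≤ τ (k + 1) - τ k) {n : ℤ} {L : ℝ}
    (hτn : ∀ k, τ (k + n) = τ k + L) (hxn : ∀ k, x (k + n) = x k) :
    Function.Periodic (piecewiseOrbit φ τ x) L := by
  intro r
  have hmono := (strictMono_of_spacing hT hτ).monotone
  obtain ⟨k, hk⟩ := exists_mem_Ico_of_spacing hT hτ r
  have hk' : r + L ∈ Ico (τ (k + n)) (τ (k + n + 1)) := by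
    rw [add_right_comm, hτn, hτn]
    exact ⟨by linarith [hk.1], by linarith [hk.2]⟩
  rw [piecewiseOrbit_of_mem_Ico hmono hk, piecewiseOrbit_of_mem_Ico hmono hk', hτn, hxn,
    add_sub_add_right_eq_sub]

theorem isPeriodicPseudoOrbit_piecewiseOrbit (hT : 0 < T) (hτ : ∀ k, T ≤ τ (k + 1) - τ k)
    (hjump : ∀ k, dist (x (k + 1)) (φ (τ (k + 1) - τ k) (x k)) < ε) {n : ℤ} {L : ℝ} (hL : 0 < L)
    (hτn : ∀ k, τ (k + n) = τ k + L) (hxn : ∀ k, x (k + n) = x k) :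
    IsPeriodicPseudoOrbit φ ε T L (piecewiseOrbit φ τ x) := by
  have hstrict := strictMono_of_spacing hT hτ
  have hright : ∀ r, ∀ᶠ s in 𝓝[≥] r,
      piecewiseOrbit φ τ x s = φ (s - r) (piecewiseOrbit φ τ x r) := fun r =>
    have ⟨_, hk⟩ := exists_mem_Ico_of_spacing hT hτ r
    eventually_piecewiseOrbit_eq hstrict.monotone hk
  have hspacing : ∀ u v, ¬ ContinuousAt (piecewiseOrbit φ τ x) u →
      ¬ ContinuousAt (piecewiseOrbit φ τ x) v → u < v → T ≤ v - u := by
    intro u v hu hv huv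
    obtain ⟨k, rfl⟩ := exists_eq_of_not_continuousAt_piecewiseOrbit hT hτ hu
    by_contra! hlt
    exact hv (continuousAt_piecewiseOrbit hstrict.monotone ⟨huv, by linarith [hτ (k + 1)]⟩)
  refine ⟨hL, periodic_piecewiseOrbit hT hτ hτn hxn, fun r => ?_, ?_, hspacing,
    fun a b hab hc => ?_, fun u hu => ?_⟩
  · exact (continuous_flow_sub φ r _).continuousWithinAt.congr_of_eventuallyEq (hright r)
      (by simp [φ.map_zero_apply])
  · exact finite_of_spacing hT (fun u hu => Ico_subset_Icc_self hu.1)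
      fun u hu v hv => hspacing u v hu.2 hv.2
  · exact eq_flow_of_eventually_eq (ψ := fun s y => φ s y)
      (fun s t y => by rw [add_comm, φ.map_add]) φ.map_zero_apply
      (fun y => φ.continuous continuous_id continuous_const) hab
      (fun r _ => (hright r).filter_mono (nhdsWithin_mono _ Ioi_subset_Ici_self)) hc
  · obtain ⟨k, rfl⟩ := exists_eq_of_not_continuousAt_piecewiseOrbit hT hτ hu
    exact ⟨_, tendsto_piecewiseOrbit_nhdsLT hstrict k,
      by rw [piecewiseOrbit_mark hstrict]; exact hjump k⟩

/-- The pairs `(t, y)` such that an `ε`-realization of `γ` may pass through `y` at time `t`. -/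
def realizationSet (ε : ℝ) (γ : ℝ → M) : Set (ℝ × M) :=
  {z | (ContinuousAt γ z.1 → z.2 = γ z.1) ∧ (¬ ContinuousAt γ z.1 → z.2 ∈ Metric.ball (γ z.1) ε)}

theorem mk_mem_realizationSet {γ : ℝ → M} (hε : 0 < ε) (t : ℝ) :
    (t, γ t) ∈ realizationSet ε γ :=
  ⟨fun _ => rfl, fun _ => Metric.mem_ball_self hε⟩

/-- A piece of an `ε`-realization of `γ`, as a curve of pairs (time, point). -/
structure IsRealizationPath (ε : ℝ) (γ : ℝ → M) {p q : ℝ × M} (A : Path p q) : Prop where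
  mem : ∀ s, A s ∈ realizationSet ε γ
  monotone : Monotone fun s => (A s).1

theorem IsRealizationPath.trans {γ : ℝ → M} {p q w : ℝ × M} {A : Path p q} {B : Path q w}
    (hA : IsRealizationPath ε γ A) (hB : IsRealizationPath ε γ B) :
    IsRealizationPath ε γ (A.trans B) := by
  refine ⟨fun s => ?_, fun s t (hst : (s : ℝ) ≤ t) => ?_⟩
  · rw [Path.trans_apply]
    split_ifs
    · exact hA.mem _
    · exact hB.mem _
  · dsimp only
    rw [Path.trans_apply, Path.trans_apply]
    split_ifs with hs ht ht
    · exact hA.monotone (Subtype.mk_le_mk.2 (by linarith))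
    · calc (A _).1 ≤ (A 1).1 := hA.monotone unitInterval.le_one'
        _ = (B 0).1 := by rw [A.target, B.source]
        _ ≤ _ := hB.monotone unitInterval.nonneg'
    · linarith
    · exact hB.monotone (Subtype.mk_le_mk.2 (by linarith))

/-- The value of a cocycle on the curve followed by a path of pairs (time, point). -/
def pathValue (c : Cocycles M) {p q : ℝ × M} (A : Path p q) : ℝ :=
  curveValue c (A.map continuous_snd).toContinuousMap

theorem pathValue_refl (c : Cocycles M) (p : ℝ × M) : pathValue c (Path.refl p) = 0 :=
  curveValue_seg_self c (ContinuousMap.const ℝ p.2) 0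

theorem pathValue_trans (c : Cocycles M) {p q w : ℝ × M} (A : Path p q) (B : Path q w) :
    pathValue c (A.trans B) = pathValue c A + pathValue c B := by
  rw [pathValue, Path.map_trans, curveValue_trans]
  rfl

variable {b : ℤ → C(unitInterval, M)}

theorem exists_isRealizationPath_arc (hτ : StrictMono τ) (hε : 0 < ε) (c : Cocycles M)
    (hmem : (τ (k + 1), φ (τ (k + 1) - τ k) (x k)) ∈ realizationSet ε (piecewiseOrbit φ τ x)) :
    ∃ A : Path (τ k, x k) (τ (k + 1), φ (τ (k + 1) - τ k) (x k)),
      IsRealizationPath ε (piecewiseOrbit φ τ x) A ∧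
      pathValue c A = curveValue c (orbitArc φ (τ (k + 1) - τ k) (x k)).toContinuousMap := by
  set l := τ (k + 1) - τ k with hl
  have hlpos : 0 < l := sub_pos.2 (hτ (lt_add_one k))
  let A : Path (τ k, x k) (τ (k + 1), φ l (x k)) :=
    { toFun := fun s => (τ k + s * l, φ (s * l) (x k))
      continuous_toFun := Continuous.prodMk (by fun_prop)
        (φ.continuous (by fun_prop) continuous_const)
      source' := by simp [φ.map_zero_apply]
      target' := by simp [hl] }
  refine ⟨A, ⟨fun s => ?_, fun s s' (hs : (s : ℝ) ≤ s') => ?_⟩, rfl⟩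
  · rcases (unitInterval.le_one s).eq_or_lt with h1 | h1
    · rwa [show s = 1 from Subtype.ext h1, A.target]
    · have h0 : 0 ≤ (s : ℝ) * l := mul_nonneg s.2.1 hlpos.le
      have hsl : (s : ℝ) * l < l := mul_lt_of_lt_one_left hlpos h1
      have hA : piecewiseOrbit φ τ x (τ k + s * l) = φ (s * l) (x k) := by
        rw [piecewiseOrbit_of_mem_Ico hτ.monotone ⟨by linarith, by linarith⟩, add_sub_cancel_left]
      change (τ k + s * l, φ (s * l) (x k)) ∈ _
      rw [← hA]
      exact mk_mem_realizationSet hε _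
  · change τ k + s * l ≤ τ k + s' * l
    gcongr

theorem exists_isRealizationPath_jump (hτ : StrictMono τ) (c : Cocycles M)
    (hb : IsJumpCurve ε (b k) (φ (τ (k + 1) - τ k) (x k)) (x (k + 1))) :
    ∃ A : Path (τ (k + 1), φ (τ (k + 1) - τ k) (x k)) (τ (k + 1), x (k + 1)),
      IsRealizationPath ε (piecewiseOrbit φ τ x) A ∧ pathValue c A = curveValue c (b k) := by
  let A : Path (τ (k + 1), φ (τ (k + 1) - τ k) (x k)) (τ (k + 1), x (k + 1)) :=
    { toFun := fun s => (τ (k + 1), b k s)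
      continuous_toFun := by fun_prop
      source' := by rw [hb.source]
      target' := by rw [hb.target] }
  have hmark := piecewiseOrbit_mark (φ := φ) (x := x) hτ (k + 1)
  refine ⟨A, ⟨fun s => ⟨fun h => ?_, fun _ => ?_⟩, fun _ _ _ => le_rfl⟩, rfl⟩
  · change b k s = piecewiseOrbit φ τ x (τ (k + 1))
    rw [hmark]
    exact hb.eq_of_eq (flow_eq_of_continuousAt_piecewiseOrbit hτ h) s
  · change b k s ∈ Metric.ball (piecewiseOrbit φ τ x (τ (k + 1))) ε
    rw [hmark]
    exact hb.mem_ball s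

theorem exists_isRealizationPath_nat (hτ : StrictMono τ) (c : Cocycles M)
    (hb : ∀ k, IsJumpCurve ε (b k) (φ (τ (k + 1) - τ k) (x k)) (x (k + 1))) (n : ℕ) :
    ∃ A : Path (τ 0, x 0) (τ n, x n), IsRealizationPath ε (piecewiseOrbit φ τ x) A ∧
      pathValue c A = ∑ k ∈ Finset.range n,
        (curveValue c (orbitArc φ (τ (k + 1) - τ k) (x k)).toContinuousMap
          + curveValue c (b k)) := by
  have hε : 0 < ε := Metric.pos_of_mem_ball ((hb 0).mem_ball 0)
  induction n with
  | zero =>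
    refine ⟨Path.refl _, ⟨fun s => ?_, fun _ _ _ => le_rfl⟩, ?_⟩
    · simpa only [Path.refl_apply, piecewiseOrbit_mark hτ] using
        mk_mem_realizationSet (γ := piecewiseOrbit φ τ x) hε (τ 0)
    · rw [Finset.sum_range_zero, pathValue_refl]
  | succ n ih =>
    obtain ⟨A, hA, hAc⟩ := ih
    obtain ⟨D, hD, hDc⟩ := exists_isRealizationPath_jump hτ c (hb n)
    obtain ⟨B, hB, hBc⟩ := exists_isRealizationPath_arc hτ hε c (D.source ▸ hD.mem 0)
    refine ⟨(A.trans B).trans D, (hA.trans hB).trans hD, ?_⟩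
    rw [pathValue_trans, pathValue_trans, hAc, hBc, hDc, Finset.sum_range_succ, add_assoc]

theorem IsRealizationPath.isRealization {γ : ℝ → M} {p q : ℝ × M} {A : Path p q} {L : ℝ}
    (hA : IsRealizationPath ε γ A) (hfst : q.1 = p.1 + L) (hsnd : q.2 = p.2) :
    IsRealization ε L γ (A.map continuous_snd).toContinuousMap where
  closed := (A.map continuous_snd).source.trans (hsnd.symm.trans (A.map continuous_snd).target.symm)
  exists_time := by
    refine ⟨(A.map continuous_fst).toContinuousMap, hA.monotone, ?_, hA.mem⟩
    exact (A.map continuous_fst).target.trans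
      (hfst.trans (congrArg (· + L) (A.map continuous_fst).source.symm))

theorem ediv_emod_add_one {n : ℕ} (hn : 0 < n) (k : ℤ) :
    ((k + 1) / n = k / n ∧ ((k + 1) % n).toNat = (k % n).toNat + 1) ∨
      ((k + 1) / n = k / n + 1 ∧ ((k + 1) % n).toNat = 0 ∧ (k % n).toNat + 1 = n) := by
  have hn' : (0 : ℤ) < n := mod_cast hn
  have h0 := Int.emod_nonneg k hn'.ne'
  have h1 := Int.emod_lt_of_pos k hn'
  have hk := Int.mul_ediv_add_emod k n
  rcases (Int.add_one_le_iff.2 h1).lt_or_eq with h | h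
  · obtain ⟨hd, hm⟩ := (Int.ediv_emod_unique hn' (a := k + 1) (q := k / n) (r := k % n + 1)).2
      ⟨by linarith, by lia, h⟩
    exact Or.inl ⟨hd, by lia⟩
  · obtain ⟨hd, hm⟩ := (Int.ediv_emod_unique hn' (a := k + 1) (q := k / n + 1) (r := 0)).2
      ⟨by linarith, le_rfl, hn'⟩
    exact Or.inr ⟨hd, by lia, by lia⟩

theorem apply_toNat_add_one_emod {α : Type*} {n : ℕ} (hn : 0 < n) {u : ℕ → α} (hu : u n = u 0)
    (k : ℤ) : u ((k + 1) % n).toNat = u ((k % n).toNat + 1) := by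
  rcases ediv_emod_add_one hn k with ⟨-, h⟩ | ⟨-, h, hkn⟩
  · rw [h]
  · rw [h, hkn, hu]

theorem exists_int_sub_eq {n : ℕ} (hn : 0 < n) (l : ℕ → ℝ) :
    ∃ τ : ℤ → ℝ, (∀ k, τ (k + 1) - τ k = l (k % n).toNat) ∧
      ∀ k, τ (k + n) = τ k + ∑ j ∈ Finset.range n, l j := by
  have hn' : (n : ℤ) ≠ 0 := mod_cast hn.ne'
  refine ⟨fun k => (k / n : ℤ) * ∑ j ∈ Finset.range n, l j + ∑ j ∈ Finset.range (k % n).toNat, l j,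
    fun k => ?_, fun k => ?_⟩
  · dsimp only
    rcases ediv_emod_add_one hn k with ⟨hd, hm⟩ | ⟨hd, hm, hkn⟩
    · rw [hd, hm, Finset.sum_range_succ]
      ring
    · have hsum : ∑ j ∈ Finset.range n, l j =
          ∑ j ∈ Finset.range (k % n).toNat, l j + l (k % n).toNat := by
        rw [← Finset.sum_range_succ, hkn]
      rw [hd, hm, hsum, Finset.sum_range_zero]
      push_cast
      ring
  · dsimp only
    rw [Int.add_emod_right, Int.add_ediv_of_dvd_right dvd_rfl, Int.ediv_self hn', Int.cast_add,
      Int.cast_one]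
    ring

theorem exists_isPeriodicPseudoOrbit_isRealization (φ : Flow ℝ M) (hT : 0 < T) (c : Cocycles M)
    {n : ℕ} (hn : 0 < n) {x : ℕ → M} {l : ℕ → ℝ} {b : ℕ → C(unitInterval, M)}
    (hl : ∀ k < n, T ≤ l k) (hx : x n = x 0)
    (hb : ∀ k < n, IsJumpCurve ε (b k) (φ (l k) (x k)) (x (k + 1))) :
    ∃ (L : ℝ) (γ : ℝ → M) (Γ : C(unitInterval, M)), IsPeriodicPseudoOrbit φ ε T L γ ∧
      IsRealization ε L γ Γ ∧ curveValue c Γ = ∑ k ∈ Finset.range n,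
        (curveValue c (orbitArc φ (l k) (x k)).toContinuousMap + curveValue c (b k)) := by
  obtain ⟨τ, hτl, hτn⟩ := exists_int_sub_eq hn l
  set L := ∑ j ∈ Finset.range n, l j
  let ι : ℤ → ℕ := fun k => (k % n).toNat
  have hι : ∀ k, ι k < n := fun k => by
    have := Int.emod_lt_of_pos k (show (0 : ℤ) < n from mod_cast hn)
    lia
  have hιn : ∀ k, ι (k + n) = ι k := fun k => congrArg Int.toNat (Int.add_emod_right k n)
  have hιk : ∀ k : ℕ, k < n → ι k = k := fun k hk => by
    simp [ι, Int.emod_eq_of_lt (Int.natCast_nonneg k) (Nat.cast_lt.2 hk)]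
  have hτ : ∀ k, T ≤ τ (k + 1) - τ k := fun k => hτl k ▸ hl _ (hι k)
  have hjump : ∀ k, IsJumpCurve ε (b (ι k)) (φ (τ (k + 1) - τ k) (x (ι k))) (x (ι (k + 1))) := by
    intro k
    rw [hτl, apply_toNat_add_one_emod hn hx]
    exact hb _ (hι k)
  have hL : 0 < L := Finset.sum_pos (fun k hk => hT.trans_le (hl k (Finset.mem_range.1 hk)))
    (Finset.nonempty_range_iff.2 hn.ne')
  obtain ⟨A, hA, hAc⟩ :=
    exists_isRealizationPath_nat (strictMono_of_spacing hT hτ) c hjump n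
  refine ⟨L, _, _, isPeriodicPseudoOrbit_piecewiseOrbit (x := fun k => x (ι k)) hT hτ
    (fun k => ?_) hL hτn fun k => by rw [hιn], hA.isRealization ?_ ?_, ?_⟩
  · rw [dist_comm, ← (hjump k).source]
    exact (hjump k).mem_ball 0
  · simpa only [zero_add] using hτn 0
  · simpa only [zero_add] using congrArg x (hιn 0)
  · refine hAc.trans (Finset.sum_congr rfl fun k hk => ?_)
    rw [hτl, show (k % n : ℤ).toNat = k from hιk k (Finset.mem_range.1 hk),
      hιk k (Finset.mem_range.1 hk)]

end OrbitArcs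

/-! ### Chains -/

section Marks

theorem exists_next_mark {D : Set ℝ} {s T : ℝ} (hT : 0 ≤ T)
    (hD : ∀ u ∈ D, ∀ v ∈ D, u < v → T ≤ v - u) (hs : ∀ u ∈ D, s < u → s + T ≤ u) :
    ∃ s' ∈ Icc (s + T) (s + 2 * T), Disjoint D (Ioo s s') ∧ ∀ u ∈ D, s' < u → s' + T ≤ u := by
  by_cases h : ∃ u ∈ D, s + T ≤ u ∧ u < s + 2 * T
  · obtain ⟨u, hu, hsu, hus⟩ := h
    refine ⟨u, ⟨hsu, hus.le⟩, disjoint_left.2 fun v hv hsv => ?_, fun v hv huv => ?_⟩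
    · linarith [hs v hv hsv.1, hD v hv u hu hsv.2]
    · linarith [hD u hu v hv huv]
  · refine ⟨s + T, ⟨le_rfl, by linarith⟩, disjoint_left.2 fun v hv hsv => ?_, fun v hv hsv => ?_⟩
    · exact (hs v hv hsv.1).not_gt hsv.2
    · by_contra! hlt
      exact h ⟨v, hv, hsv.le, by linarith⟩

theorem exists_marks {D : Set ℝ} {T : ℝ} (hT : 0 ≤ T)
    (hD : ∀ u ∈ D, ∀ v ∈ D, u < v → T ≤ v - u) (hD₀ : ∀ u ∈ D, 0 < u → T ≤ u) :
    ∃ σ : ℕ → ℝ, σ 0 = 0 ∧ (∀ k, σ (k + 1) - σ k ∈ Icc T (2 * T)) ∧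
      ∀ k, Disjoint D (Ioo (σ k) (σ (k + 1))) := by
  choose! next hnext hfree hinv using fun s => exists_next_mark (s := s) hT hD
  have hσ : ∀ k, ∀ u ∈ D, next^[k] 0 < u → next^[k] 0 + T ≤ u := by
    intro k
    induction k with
    | zero => simpa using hD₀
    | succ k ih =>
      rw [Function.iterate_succ_apply']
      exact hinv _ ih
  refine ⟨fun k => next^[k] 0, rfl, fun k => ?_, fun k => ?_⟩
  · obtain ⟨h₁, h₂⟩ := hnext _ (hσ k)
    rw [← Function.iterate_succ_apply' next] at h₁ h₂
    constructor <;> linarith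
  · simpa only [Function.iterate_succ_apply'] using hfree _ (hσ k)

theorem monotone_of_spacing {σ : ℕ → ℝ} {T : ℝ} (hT : 0 ≤ T) (hσ : ∀ k, T ≤ σ (k + 1) - σ k) :
    Monotone σ :=
  monotone_nat_of_le_succ fun k => by linarith [hσ k]

theorem exists_mem_Ico_of_nat_spacing {σ : ℕ → ℝ} {T : ℝ} (hT : 0 < T)
    (hσ : ∀ k, T ≤ σ (k + 1) - σ k) {t : ℝ} (ht : σ 0 ≤ t) :
    ∃ n, t ∈ Ico (σ n) (σ (n + 1)) := by
  have hgrowth : ∀ k : ℕ, k * T + σ 0 ≤ σ k := by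
    intro k
    induction k with
    | zero => simp
    | succ k ih =>
      push_cast
      linarith [hσ k]
  have hunbounded : Tendsto σ atTop atTop :=
    tendsto_atTop_mono hgrowth (tendsto_atTop_add_const_right _ _
      (tendsto_natCast_atTop_atTop.atTop_mul_const hT))
  have hcover := iUnion_Ico_map_succ_eq_Ici
    (fun k => monotone_of_spacing hT.le hσ (Nat.zero_le k))
    (not_bddAbove_of_tendsto_atTop hunbounded)
  exact mem_iUnion.1 (hcover.ge ht)

end Marks

section FlowChains

variable {N : Type*} {ψ : ℝ → N → N} {d : N → N → ℝ} {ε ρ ρ' T : ℝ} {n : ℕ} {x : ℕ → N}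
  {τ : ℕ → ℝ}

/-- The `(ρ, T)`-chains `x 0, …, x n` of `ψ`, where `ψ` is followed from `x k` during the time
`τ k ≥ T` up to a point `ρ`-close to `x (k + 1)`. The values of `x` after `n`, and of `τ` from `n`
on, are ignored. -/
structure IsFlowChain (ψ : ℝ → N → N) (d : N → N → ℝ) (ρ T : ℝ) (n : ℕ) (x : ℕ → N)
    (τ : ℕ → ℝ) : Prop where
  le_time : ∀ k < n, T ≤ τ k
  dist_lt : ∀ k < n, d (ψ (τ k) (x k)) (x (k + 1)) < ρ

theorem IsFlowChain.mono (h : IsFlowChain ψ d ρ T n x τ) (hρ : ρ ≤ ρ') :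
    IsFlowChain ψ d ρ' T n x τ :=
  ⟨h.le_time, fun k hk => (h.dist_lt k hk).trans_le hρ⟩

theorem IsFlowChain.shift (h : IsFlowChain ψ d ρ T n x τ) {i m : ℕ} (him : i + m ≤ n) :
    IsFlowChain ψ d ρ T m (fun k => x (i + k)) fun k => τ (i + k) :=
  ⟨fun _ _ => h.le_time _ (by lia), fun _ _ => h.dist_lt _ (by lia)⟩

theorem IsFlowChain.update_last (hd : ∀ x y z, d x z ≤ d x y + d y z)
    (h : IsFlowChain ψ d ρ T n x τ) (hρ' : 0 ≤ ρ') {z : N} (hz : d (x n) z < ρ') :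
    IsFlowChain ψ d (ρ + ρ') T n (Function.update x n z) τ := by
  refine ⟨h.le_time, fun k hk => ?_⟩
  have hk' := h.dist_lt k hk
  rw [Function.update_of_ne hk.ne]
  by_cases hkn : k + 1 = n
  · subst hkn
    rw [Function.update_self]
    exact (hd _ (x (k + 1)) _).trans_lt (by linarith)
  · rw [Function.update_of_ne hkn]
    linarith

end FlowChains

section PseudoOrbits

variable {N : Type*} [TopologicalSpace N] {ψ : ℝ → N → N} {d : N → N → ℝ} {ε T l : ℝ} {γ : ℝ → N}

namespace IsPseudoOrbit

theorem apply_eq (hγ : IsPseudoOrbit ψ d ε T l γ) {s r : ℝ} (hs : 0 ≤ s) (hsr : s ≤ r)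
    (hr : r < l) (hc : ∀ u ∈ Ioc s r, ContinuousWithinAt γ (Ico 0 l) u) :
    γ r = ψ (r - s) (γ s) := by
  refine hγ.orbit s r hs hsr hr fun u hu => ?_
  rcases hu.1.eq_or_lt with rfl | hsu
  · exact (hγ.right_continuous s ⟨hs, hu.2.trans_lt hr⟩).mono (Icc_subset_Ico_right hr)
  · exact (hc u ⟨hsu, hu.2⟩).mono fun z hz => ⟨hs.trans hz.1, hz.2.trans_lt hr⟩

theorem dist_flow_lt [T2Space N] (hγ : IsPseudoOrbit ψ d ε T l γ) (hself : ∀ x, d x x = 0)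
    (hsymm : ∀ x y, d x y = d y x) (hψ : ∀ x, Continuous fun t => ψ t x) (hε : 0 < ε) {s r : ℝ}
    (hs : 0 ≤ s) (hsr : s < r) (hr : r < l)
    (hc : ∀ u ∈ Ioo s r, ContinuousWithinAt γ (Ico 0 l) u) :
    d (ψ (r - s) (γ s)) (γ r) < ε := by
  by_cases hcr : ContinuousWithinAt γ (Ico 0 l) r
  · rw [← hγ.apply_eq hs hsr.le hr fun u hu => ?_, hself]
    · exact hε
    · rcases hu.2.eq_or_lt with rfl | hur
      exacts [hcr, hc u ⟨hu.1, hur⟩]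
  · obtain ⟨y, hy, hdy⟩ := hγ.jump r ⟨hs.trans hsr.le, hr⟩ hcr
    have hlim : Tendsto γ (𝓝[<] r) (𝓝 (ψ (r - s) (γ s))) := by
      have hflow : Continuous fun u => ψ (u - s) (γ s) := (hψ (γ s)).comp (by fun_prop)
      refine ((hflow.tendsto r).mono_left nhdsWithin_le_nhds).congr' ?_
      filter_upwards [Ioo_mem_nhdsLT hsr] with u hu
      exact (hγ.apply_eq hs hu.1.le (hu.2.trans hr) fun v hv =>
        hc v ⟨hv.1, hv.2.trans_lt hu.2⟩).symm
    rw [tendsto_nhds_unique hlim hy, hsymm]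
    exact hdy

theorem exists_isFlowChain [T2Space N] (hγ : IsPseudoOrbit ψ d ε T l γ)
    (hself : ∀ x, d x x = 0) (hsymm : ∀ x y, d x y = d y x)
    (hψ : ∀ x, Continuous fun t => ψ t x) (hε : 0 < ε) (hT : 0 < T) {t : ℝ} (ht : t ∈ Ico 0 l) :
    ∃ (n : ℕ) (x : ℕ → N) (τ : ℕ → ℝ), ∃ s ∈ Icc 0 (2 * T), x 0 = γ 0 ∧
      IsFlowChain ψ d ε T n x τ ∧ (∀ k, τ k ≤ 2 * T) ∧ γ t = ψ s (x n) := by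
  obtain ⟨σ, hσ0, hσ, hfree⟩ := exists_marks (T := T)
    (D := {u | u ∈ Ico 0 l ∧ ¬ ContinuousWithinAt γ (Ico 0 l) u}) hT.le
    (fun u hu v hv => hγ.spacing u hu.1 v hv.1 hu.2 hv.2) fun u hu _ => hγ.disjoint u hu.1 hu.2
  have hmono : Monotone σ := monotone_of_spacing hT.le fun k => (hσ k).1
  have hnonneg : ∀ k, 0 ≤ σ k := fun k => hσ0 ▸ hmono (Nat.zero_le k)
  have hcont : ∀ k, ∀ u ∈ Ioo (σ k) (σ (k + 1)), u < l → ContinuousWithinAt γ (Ico 0 l) u := by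
    intro k u hu hul
    by_contra hc
    exact disjoint_left.1 (hfree k) ⟨⟨(hnonneg k).trans hu.1.le, hul⟩, hc⟩ hu
  obtain ⟨n, hnt, htn⟩ := exists_mem_Ico_of_nat_spacing hT (fun k => (hσ k).1) (hσ0.trans_le ht.1)
  refine ⟨n, fun k => γ (σ k), fun k => σ (k + 1) - σ k, t - σ n, ?_, congrArg γ hσ0,
    ⟨fun k _ => (hσ k).1, fun k hk => ?_⟩, fun k => (hσ k).2, ?_⟩
  · have := (hσ n).2
    constructor <;> linarith
  · have hkl : σ (k + 1) < l := (hmono hk).trans_lt (hnt.trans_lt ht.2)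
    exact hγ.dist_flow_lt hself hsymm hψ hε (hnonneg k) (by linarith [(hσ k).1]) hkl
      fun u hu => hcont k u hu (hu.2.trans hkl)
  · exact hγ.apply_eq (hnonneg n) hnt ht.2 fun u hu =>
      hcont n u ⟨hu.1, hu.2.trans_lt htn⟩ (hu.2.trans_lt ht.2)

end IsPseudoOrbit

end PseudoOrbits

section LiftedChains

open Cover

theorem le_add_card_mul {ι : Type*} {color : ℕ → ι} {u : ℕ → ℝ} {C D : ℝ}
    (hC : 0 ≤ C) (hD : 0 ≤ D) {n : ℕ} (hstep : ∀ k < n, u (k + 1) ≤ u k + C)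
    (hcolor : ∀ i j, i < j → j ≤ n → color i = color j → u j ≤ u i + D) (S : Finset ι) :
    ∀ i ≤ n, (∀ k, i ≤ k → k ≤ n → color k ∈ S) → u n ≤ u i + S.card * (C + D) := by
  classical
  induction S using Finset.strongInduction with
  | H S ih =>
    intro i hin hS
    -- After the last index `j` with the color of `i`, one color fewer is available.
    obtain ⟨j, ⟨hij, hjn, hj⟩, hlast⟩ : ∃ j, (i ≤ j ∧ j ≤ n ∧ color i = color j) ∧
        ∀ k, j < k → k ≤ n → color i ≠ color k := by
      obtain ⟨j, hj, hmax⟩ := Finset.exists_max_image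
        ((Finset.Icc i n).filter fun j => color i = color j) id ⟨i, by simp [hin]⟩
      simp only [Finset.mem_filter, Finset.mem_Icc, id, and_assoc] at hj hmax
      exact ⟨j, hj, fun k hjk hkn hk => (hmax k ⟨hj.1.trans hjk.le, hkn, hk⟩).not_gt hjk⟩
    have hji : u j ≤ u i + D := by
      rcases hij.eq_or_lt with rfl | hlt
      exacts [by linarith, hcolor i j hlt hjn hj]
    have hiS : color i ∈ S := hS i le_rfl hin
    have hcard : (S.card : ℝ) = (S.erase (color i)).card + 1 := by
      exact_mod_cast (Finset.card_erase_add_one hiS).symm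
    have hnonneg : 0 ≤ ((S.erase (color i)).card : ℝ) * (C + D) := by positivity
    rw [hcard, add_mul, one_mul]
    rcases hjn.eq_or_lt with rfl | hlt
    · linarith
    · have htail := ih (S.erase (color i)) (Finset.erase_ssubset hiS) (j + 1) hlt
        fun k hjk hkn => Finset.mem_erase.2 ⟨(hlast k hjk hkn).symm, hS k (by lia) hkn⟩
      linarith [hstep j hlt]

variable {M : Type*} [MetricSpace M] [CompactSpace M] [LocallyPathConnectedSpace M]
  [ConnectedSpace M] {x₀ : M} {K : Submodule ℤ (H1 ℤ M)} {d : Cover x₀ K → Cover x₀ K → ℝ}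
  {φ : Flow ℝ M} {ε T : ℝ} {c : Cocycles M}

theorem exists_forall_isFlowChain_primitive_le (hd : IsLiftedMetric d) (hε : 0 < ε) (hT : 0 < T)
    (hK : K ≤ intKer (Submodule.Quotient.mk c))
    (h : ∀ (l : ℝ) (γ : ℝ → M), IsPeriodicPseudoOrbit φ ε T l γ →
      ∀ h, IsClassOf ε l γ h → eval ℝ (Submodule.Quotient.mk c) h ≤ 0) :
    ∃ ρ > 0, ∀ (n : ℕ) (x : ℕ → Cover x₀ K) (τ : ℕ → ℝ), 0 < n →
      IsFlowChain (liftFlow φ) d ρ T n x τ → (x n).proj = (x 0).proj →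
      primitive c (x n) ≤ primitive c (x 0) := by
  obtain ⟨ρ, hρ, hlink⟩ := hd.exists_forall_exists_link hε
  refine ⟨ρ, hρ, fun n x τ hn hx hclosed => ?_⟩
  have : Nonempty C(unitInterval, M) := ⟨.const _ x₀⟩
  choose! b hb using fun k hk => hlink _ _ (hx.dist_lt k hk)
  simp only [proj_liftFlow] at hb
  obtain ⟨L, γ, Γ, hγ, hΓ, hsum⟩ := exists_isPeriodicPseudoOrbit_isRealization φ hT c hn
    (x := fun k => (x k).proj) hx.le_time hclosed fun k hk => (hb k hk).1
  have htelescope : ∀ k ≤ n, primitive c (x k) = primitive c (x 0) + ∑ j ∈ Finset.range k,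
      (curveValue c (orbitArc φ (τ j) (x j).proj).toContinuousMap + curveValue c (b j)) := by
    intro k
    induction k with
    | zero => simp
    | succ k ih =>
      intro hk
      rw [Finset.sum_range_succ, (hb k hk).2.primitive_eq hK,
        (link_liftFlow φ (τ k) (x k)).primitive_eq hK, ih (Nat.le_of_succ_le hk)]
      ring
  have hle := h L γ hγ _ ⟨Γ, hΓ, rfl⟩
  rw [eval_loopClass, hsum] at hle
  rw [htelescope n le_rfl]
  linarith

theorem exists_forall_isFlowChain_apply_le_add_one (hd : IsLiftedMetric d) (hε : 0 < ε)
    (hT : 0 < T) (hK : K ≤ intKer (Submodule.Quotient.mk c))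
    (h : ∀ (l : ℝ) (γ : ℝ → M), IsPeriodicPseudoOrbit φ ε T l γ →
      ∀ h, IsClassOf ε l γ h → eval ℝ (Submodule.Quotient.mk c) h ≤ 0)
    {f : Cover x₀ K → ℝ} (hfc : Continuous f) (hf : IsEquivariant (Submodule.Quotient.mk c) f) :
    ∃ ρ > 0, ∃ δ > 0, ∀ (n : ℕ) (x : ℕ → Cover x₀ K) (τ : ℕ → ℝ), 0 < n →
      IsFlowChain (liftFlow φ) d ρ T n x τ → dist (x n).proj (x 0).proj < δ →
      f (x n) ≤ f (x 0) + 1 := by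
  obtain ⟨ρ₁, hρ₁, hvar⟩ := hd.exists_forall_abs_sub_lt hK hfc hf one_pos
  obtain ⟨ρ₂, hρ₂, hloop⟩ := exists_forall_isFlowChain_primitive_le hd hε hT hK h
  obtain ⟨ε₁, hε₁, hlink⟩ := hd.exists_forall_link_lt (lt_min hρ₁ (half_pos hρ₂))
  obtain ⟨δ, hδ, hjoin⟩ := exists_forall_joinedIn_ball (M := M) hε₁
  refine ⟨ρ₂ / 2, half_pos hρ₂, δ, hδ, fun n x τ hn hx hnear => ?_⟩
  obtain ⟨a, ha⟩ := hjoin _ _ hnear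
  obtain ⟨z, hz⟩ := Link.exists_right (x n) a.toContinuousMap a.source.symm
  have hxz := hlink _ _ _ _ ha hz
  have hzx : z.proj = (x 0).proj := hz.proj_right.trans a.target
  have hclosed := (hx.update_last hd.triangle (half_pos hρ₂).le
    (hxz.trans_le (min_le_right _ _))).mono (add_halves ρ₂).le
  have hle := hloop n _ τ hn hclosed (by
    rwa [Function.update_self, Function.update_of_ne hn.ne])
  rw [Function.update_self, Function.update_of_ne hn.ne] at hle
  have hequiv := (isEquivariant_iff_sub_eq_sub hK).1 hf (x 0) z hzx.symm
  have hfz := neg_lt_of_abs_lt (hvar _ _ (hxz.trans_le (min_le_left _ _)))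
  linarith

theorem exists_forall_isFlowChain_apply_le_add (hd : IsLiftedMetric d) (hε : 0 < ε)
    (hT : 0 < T) (hK : K ≤ intKer (Submodule.Quotient.mk c))
    (h : ∀ (l : ℝ) (γ : ℝ → M), IsPeriodicPseudoOrbit φ ε T l γ →
      ∀ h, IsClassOf ε l γ h → eval ℝ (Submodule.Quotient.mk c) h ≤ 0)
    {f : Cover x₀ K → ℝ} (hfc : Continuous f) (hf : IsEquivariant (Submodule.Quotient.mk c) f)
    (S : ℝ) :
    ∃ ρ > 0, ∃ C ≥ 0, ∀ (n : ℕ) (x : ℕ → Cover x₀ K) (τ : ℕ → ℝ),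
      IsFlowChain (liftFlow φ) d ρ T n x τ → (∀ k, τ k ≤ S) → f (x n) ≤ f (x 0) + C := by
  obtain ⟨ρ₁, hρ₁, hvar⟩ := hd.exists_forall_abs_sub_lt hK hfc hf one_pos
  obtain ⟨C, hC, hflow⟩ := exists_forall_apply_liftFlow_le_add hd hK hfc hf φ S
  obtain ⟨ρ₂, hρ₂, δ, hδ, hreturn⟩ :=
    exists_forall_isFlowChain_apply_le_add_one hd hε hT hK h hfc hf
  obtain ⟨Z, hZ⟩ := exists_finset_forall_exists_dist_lt M (half_pos hδ)
  choose color hcolorZ hcolor using hZ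
  refine ⟨min ρ₁ ρ₂, lt_min hρ₁ hρ₂, Z.card * (C + 1 + 1), by positivity, fun n x τ hx hτ => ?_⟩
  refine le_add_card_mul (color := fun k => color (x k).proj) (u := fun k => f (x k))
    (by positivity) zero_le_one (fun k hk => ?_) (fun i j hij hjn hc => ?_) Z 0 n.zero_le
    fun k _ _ => hcolorZ _
  · have hjump := hvar _ _ ((hx.dist_lt k hk).trans_le (min_le_left _ _))
    linarith [hflow (x k) (τ k) ⟨hT.le.trans (hx.le_time k hk), hτ k⟩, lt_of_abs_lt hjump]
  · have hnear : dist (x j).proj (x i).proj < δ := by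
      have hi := hcolor (x i).proj
      rw [show color (x i).proj = color (x j).proj from hc] at hi
      linarith [hcolor (x j).proj, dist_triangle_right (x j).proj (x i).proj (color (x j).proj)]
    have hsub := (hx.shift (i := i) (m := j - i) (by lia)).mono (min_le_right _ _)
    simpa only [add_zero, Nat.add_sub_cancel' hij.le] using hreturn (j - i) _ _ (by lia) hsub
      (by simpa only [add_zero, Nat.add_sub_cancel' hij.le] using hnear)

theorem isQuasiLyapunov_of_forall_periodic (hd : IsLiftedMetric d) (hε : 0 < ε) (hT : 0 < T)
    (hK : K ≤ intKer (Submodule.Quotient.mk c))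
    (h : ∀ (l : ℝ) (γ : ℝ → M), IsPeriodicPseudoOrbit φ ε T l γ →
      ∀ h, IsClassOf ε l γ h → eval ℝ (Submodule.Quotient.mk c) h ≤ 0) :
    IsQuasiLyapunov φ T d (Submodule.Quotient.mk c) := by
  intro f hfc hf
  obtain ⟨C, hC, hflow⟩ := exists_forall_apply_liftFlow_le_add hd hK hfc hf φ (2 * T)
  obtain ⟨ρ, hρ, C', hC', hchain⟩ :=
    exists_forall_isFlowChain_apply_le_add hd hε hT hK h hfc hf (2 * T)
  refine ⟨C + C', by positivity, ρ, hρ, fun l γ hγ t ht => ?_⟩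
  have := hd.t2Space
  obtain ⟨n, x, τ, s, hs, hx0, hx, hτ, hγt⟩ := hγ.exists_isFlowChain hd.self hd.symm
    (fun x => (isLift_liftFlow φ x).continuous) hρ hT ht
  rw [hγt, ← hx0]
  linarith [hflow (x n) s hs, hchain n x τ hx hτ]

end LiftedChains

/-! ### Periodic realizations -/

section Adjoints

variable {τ σ σ' : ℝ → ℝ}

theorem exists_upperAdjoint (hc : Continuous τ) (hm : Monotone τ) (hs : Function.Surjective τ) :
    ∃ σ, GaloisConnection τ σ := by
  refine ⟨fun v => sSup {s | τ s ≤ v}, fun s v => ?_⟩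
  have hne : {s | τ s ≤ v}.Nonempty := (hs v).imp fun _ h => h.le
  have hbdd : BddAbove {s | τ s ≤ v} := by
    obtain ⟨s₁, hs₁⟩ := hs (v + 1)
    exact ⟨s₁, fun s (hsv : τ s ≤ v) => le_of_lt (hm.reflect_lt (by linarith))⟩
  have hclosed : IsClosed {s | τ s ≤ v} := isClosed_le hc continuous_const
  exact ⟨fun h => le_csSup hbdd h, fun h => (hm h).trans (hclosed.csSup_mem hne hbdd)⟩

theorem exists_lowerAdjoint (hc : Continuous τ) (hm : Monotone τ) (hs : Function.Surjective τ) :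
    ∃ σ', GaloisConnection σ' τ := by
  obtain ⟨σ, hσ⟩ := exists_upperAdjoint (τ := fun s => -τ (-s)) (by fun_prop)
    (fun _ _ h => neg_le_neg (hm (neg_le_neg h)))
    (neg_surjective.comp (hs.comp neg_surjective))
  refine ⟨fun v => -σ (-v), fun v s => ?_⟩
  simpa [neg_le, iff_comm] using hσ (-s) (-v)

theorem apply_upperAdjoint (gc : GaloisConnection τ σ) (hs : Function.Surjective τ) (v : ℝ) :
    τ (σ v) = v := by
  obtain ⟨s, rfl⟩ := hs v
  exact gc.l_u_l_eq_l s

theorem apply_eq_of_mem_Icc_adjoints (gc : GaloisConnection τ σ) (gc' : GaloisConnection σ' τ)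
    {v s : ℝ} (h : s ∈ Icc (σ' v) (σ v)) : τ s = v :=
  le_antisymm (gc.l_le h.2) (gc'.le_u h.1)

theorem lowerAdjoint_le_upperAdjoint (gc : GaloisConnection τ σ) (gc' : GaloisConnection σ' τ)
    (hs : Function.Surjective τ) (v : ℝ) : σ' v ≤ σ v :=
  gc'.l_le (apply_upperAdjoint gc hs v).ge

theorem continuousWithinAt_upperAdjoint (gc : GaloisConnection τ σ) (v : ℝ) :
    ContinuousWithinAt σ (Ici v) v := by
  refine tendsto_order.2 ⟨fun s hs => ?_, fun s hs => ?_⟩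
  · filter_upwards [self_mem_nhdsWithin] with w hw
    exact hs.trans_le (gc.monotone_u hw)
  · filter_upwards [Ico_mem_nhdsGE (gc.lt_iff_lt.2 hs)] with w hw
    exact gc.lt_iff_lt.1 hw.2

theorem tendsto_upperAdjoint_nhdsLT (gc : GaloisConnection τ σ) (gc' : GaloisConnection σ' τ)
    (hs : Function.Surjective τ) (v : ℝ) : Tendsto σ (𝓝[<] v) (𝓝 (σ' v)) := by
  refine tendsto_order.2 ⟨fun s hsv => ?_, fun s hsv => ?_⟩
  · obtain ⟨s₁, hs₁, hs₁v⟩ := exists_between hsv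
    filter_upwards [Ioo_mem_nhdsLT (gc'.lt_iff_lt.1 hs₁v)] with w hw
    exact hs₁.trans_le (gc.le_u hw.1.le)
  · filter_upwards [self_mem_nhdsWithin] with w (hw : w < v)
    refine (gc'.lt_iff_lt.2 ?_).trans hsv
    rwa [apply_upperAdjoint gc hs]

end Adjoints

section PeriodicExtension

/-- The fractional part of a real number, as a point of the unit interval. -/
def unitFract (s : ℝ) : unitInterval := ⟨Int.fract s, Int.fract_nonneg s, (Int.fract_lt_one s).le⟩

theorem continuous_comp_unitFract {X : Type*} [TopologicalSpace X] (f : C(unitInterval, X))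
    (h : f 0 = f 1) : Continuous fun s => f (unitFract s) := by
  have hext : Continuous (IccExtend zero_le_one f ∘ Int.fract) :=
    ContinuousOn.comp_fract'' f.continuous.Icc_extend'.continuousOn (by simpa using h)
  exact hext.congr fun s => IccExtend_of_mem _ _ (unitFract s).2

theorem unitFract_add_one (s : ℝ) : unitFract (s + 1) = unitFract s :=
  Subtype.ext (Int.fract_add_one s)

theorem unitFract_coe {t : unitInterval} (ht : t < 1) : unitFract t = t :=
  Subtype.ext (Int.fract_eq_self.2 ⟨t.2.1, ht⟩)

theorem continuous_add_mul_floor {l : ℝ} (f : C(unitInterval, ℝ)) (h : f 1 = f 0 + l) :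
    Continuous fun s => f (unitFract s) + ⌊s⌋ * l := by
  let g : C(unitInterval, ℝ) := ⟨fun t => f t - t * l, by fun_prop⟩
  have hg := continuous_comp_unitFract g (by simp [g, h])
  refine (hg.add (continuous_mul_const l)).congr fun s => ?_
  change f (unitFract s) - Int.fract s * l + s * l = _
  rw [Int.fract]
  ring

theorem monotone_add_mul_floor {l : ℝ} (hl : 0 ≤ l) {f : unitInterval → ℝ} (hf : Monotone f)
    (h : f 1 = f 0 + l) : Monotone fun s => f (unitFract s) + ⌊s⌋ * l := by
  intro s s' hs
  dsimp only
  rcases (Int.floor_le_floor hs).eq_or_lt with hfloor | hfloor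
  · have hfract : unitFract s ≤ unitFract s' := Subtype.mk_le_mk.2 (by
      rw [Int.fract, Int.fract, hfloor]
      gcongr)
    rw [hfloor]
    gcongr
    exact hf hfract
  · have hfloor' : (⌊s⌋ + 1 : ℝ) * l ≤ ⌊s'⌋ * l := by
      gcongr
      exact_mod_cast hfloor
    calc f (unitFract s) + ⌊s⌋ * l ≤ f 1 + ⌊s⌋ * l := by gcongr; exact hf unitInterval.le_one'
      _ = f 0 + (⌊s⌋ + 1) * l := by rw [h]; ring
      _ ≤ f (unitFract s') + ⌊s'⌋ * l := by gcongr; exact hf unitInterval.nonneg'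

theorem apply_add_nat_of_apply_add_one {τ : ℝ → ℝ} {l : ℝ} (h : ∀ s, τ (s + 1) = τ s + l) (s : ℝ)
    (k : ℕ) : τ (s + k) = τ s + k * l := by
  induction k with
  | zero => simp
  | succ k ih =>
    push_cast
    rw [← add_assoc, h, ih]
    ring

theorem surjective_of_apply_add_one {τ : ℝ → ℝ} {l : ℝ} (hl : 0 < l) (hτ : Continuous τ)
    (h : ∀ s, τ (s + 1) = τ s + l) : Function.Surjective τ := by
  have hnat := apply_add_nat_of_apply_add_one h
  intro v
  obtain ⟨k, hk⟩ := exists_nat_ge (|v - τ 0| / l)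
  obtain ⟨hlow, hhigh⟩ := abs_le.1 ((div_le_iff₀ hl).1 hk)
  refine mem_range_of_exists_le_of_exists_ge hτ ⟨-k, ?_⟩ ⟨0 + k, ?_⟩
  · have := hnat (-k) k
    rw [neg_add_cancel] at this
    linarith
  · rw [hnat]
    linarith

theorem continuousAt_add_iff_of_periodic {X : Type*} [TopologicalSpace X] {f : ℝ → X} {a : ℝ}
    (h : Function.Periodic f a) (t : ℝ) : ContinuousAt f (t + a) ↔ ContinuousAt f t := by
  have hcomp : f ∘ Homeomorph.addRight a = f := funext h
  have hiff := (Homeomorph.addRight a).comp_continuousAt_iff' f t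
  rw [hcomp] at hiff
  exact hiff.symm

end PeriodicExtension

section PeriodicRealization

variable {M : Type*} [MetricSpace M] {ε l : ℝ} {γ : ℝ → M}

/-- The unrolled form of an `ε`-realization: a `1`-periodic curve `A` on `ℝ` that passes at each
parameter `s` through a point allowed at time `τ s`, where `τ` increases by the length `l` of `γ`
over each period. -/
structure IsPeriodicRealization (ε l : ℝ) (γ : ℝ → M) (A : C(ℝ, M)) (τ : ℝ → ℝ) : Prop where
  periodic : Function.Periodic A 1
  continuous_time : Continuous τ
  monotone_time : Monotone τ
  time_add_one : ∀ s, τ (s + 1) = τ s + l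
  mem : ∀ s, (τ s, A s) ∈ realizationSet ε γ

theorem mk_add_mem_realizationSet_iff {a : ℝ} (h : Function.Periodic γ a) (t : ℝ) (y : M) :
    (t + a, y) ∈ realizationSet ε γ ↔ (t, y) ∈ realizationSet ε γ := by
  simp only [realizationSet, mem_ofPred_eq, continuousAt_add_iff_of_periodic h t, h t]

theorem IsRealization.exists_isPeriodicRealization {Γ : C(unitInterval, M)}
    (hΓ : IsRealization ε l γ Γ) (hl : 0 ≤ l) (hγ : Function.Periodic γ l) :
    ∃ A τ, IsPeriodicRealization ε l γ A τ ∧ seg A 0 1 = Γ := by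
  obtain ⟨τ, hτ, hτl, hmem⟩ := hΓ.exists_time
  refine ⟨⟨_, continuous_comp_unitFract Γ hΓ.closed⟩, fun s => τ (unitFract s) + ⌊s⌋ * l,
    ⟨fun s => congrArg Γ (unitFract_add_one s), continuous_add_mul_floor τ hτl,
      monotone_add_mul_floor hl hτ hτl, fun s => ?_, fun s => ?_⟩, ?_⟩
  · rw [unitFract_add_one, Int.floor_add_one]
    push_cast
    ring
  · exact (mk_add_mem_realizationSet_iff (hγ.int_mul _) _ _).2 (hmem (unitFract s))
  · ext t
    change Γ (unitFract (0 + (1 - 0) * t)) = Γ t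
    rw [sub_zero, one_mul, zero_add]
    rcases unitInterval.le_one'.eq_or_lt (a := t) with rfl | ht
    · rw [← hΓ.closed]
      exact congrArg Γ (Subtype.ext Int.fract_one)
    · rw [unitFract_coe ht]

end PeriodicRealization

/-! ### Lifting periodic pseudo-orbits -/

section TwoSided

theorem isPseudoOrbit_comp_add {N : Type*} [TopologicalSpace N] {ψ : ℝ → N → N}
    {d : N → N → ℝ} {ε T L v : ℝ} {β : ℝ → N} (hT : 0 < T) (hL : 0 < L)
    (hright : ∀ t, ContinuousWithinAt β (Ici t) t)
    (hspacing : ∀ s t, ¬ ContinuousAt β s → ¬ ContinuousAt β t → s < t → T ≤ t - s)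
    (horbit : ∀ s t, s ≤ t → ContinuousOn β (Icc s t) → β t = ψ (t - s) (β s))
    (hjump : ∀ t, ¬ ContinuousAt β t → ∃ y, Tendsto β (𝓝[<] t) (𝓝 y) ∧ d (β t) y < ε)
    (hv : ∀ t, ¬ ContinuousAt β t → v < t → T ≤ t - v) :
    IsPseudoOrbit ψ d ε T L fun t => β (v + t) := by
  have hdisc : ∀ t ∈ Ico 0 L, ¬ ContinuousWithinAt (fun t => β (v + t)) (Ico 0 L) t →
      0 < t ∧ ¬ ContinuousAt β (v + t) := by
    intro t ht hc
    refine ⟨ht.1.lt_of_ne ?_, fun h => hc (h.comp (by fun_prop)).continuousWithinAt⟩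
    rintro rfl
    exact hc ((hright (v + 0)).comp (by fun_prop) fun t ht => by simpa using ht.1)
  refine
    { length_pos := hL
      right_continuous := fun t _ => (hright (v + t)).comp (by fun_prop) fun s hs => by
        simpa using hs.1
      finite := finite_of_spacing hT (fun t ht => Ico_subset_Icc_self ht.1) fun s hs t ht hst => ?_
      disjoint := fun t ht hc => ?_
      spacing := fun s hs t ht hs' ht' hst => ?_
      orbit := fun t s _ hts _ hc => ?_
      jump := fun t ht hc => ?_ }
  · have := hspacing _ _ (hdisc s hs.1 hs.2).2 (hdisc t ht.1 ht.2).2 (by linarith)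
    linarith
  · obtain ⟨ht0, hct⟩ := hdisc t ht hc
    linarith [hv _ hct (by linarith)]
  · linarith [hspacing _ _ (hdisc s hs hs').2 (hdisc t ht ht').2 (by linarith)]
  · have hβ : ContinuousOn β (Icc (v + t) (v + s)) :=
      (hc.comp (f := fun u => u - v) (by fun_prop) fun u hu =>
        ⟨by linarith [hu.1], by linarith [hu.2]⟩).congr fun u _ => by simp
    simpa using horbit (v + t) (v + s) (by linarith) hβ
  · obtain ⟨y, hy, hdy⟩ := hjump _ (hdisc t ht hc).2
    exact ⟨y, hy.comp (map_add_left_nhdsLT (c := v)).le, hdy⟩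

end TwoSided

section Lift

variable {M : Type*} [MetricSpace M]

namespace IsPeriodicPseudoOrbit

variable {φ : Flow ℝ M} {ε T l : ℝ} {γ : ℝ → M}

theorem eventually_continuousAt (hγ : IsPeriodicPseudoOrbit φ ε T l γ) (hT : 0 < T) (v : ℝ) :
    ∀ᶠ w in 𝓝[>] v, ContinuousAt γ w := by
  by_cases h : ∃ u ∈ Ioo v (v + T), ¬ ContinuousAt γ u
  · obtain ⟨u, ⟨hvu, huv⟩, hu⟩ := h
    filter_upwards [Ioo_mem_nhdsGT hvu] with w hw
    by_contra hc
    linarith [hγ.spacing w u hc hu hw.2, hw.1]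
  · push Not at h
    filter_upwards [Ioo_mem_nhdsGT (lt_add_of_pos_right v hT)] with w hw using h w hw

theorem eventually_eq_flow (hγ : IsPeriodicPseudoOrbit φ ε T l γ) (hT : 0 < T) (v : ℝ) :
    ∀ᶠ w in 𝓝[>] v, γ w = φ (w - v) (γ v) := by
  obtain ⟨b, hvb, hb⟩ := mem_nhdsGT_iff_exists_Ioo_subset.1 (hγ.eventually_continuousAt hT v)
  filter_upwards [Ioo_mem_nhdsGT hvb] with w hw
  refine hγ.orbit v w hw.1.le fun u hu => ?_
  rcases hu.1.eq_or_lt with rfl | hvu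
  · exact (hγ.right_continuous _).mono Icc_subset_Ici_self
  · exact (hb ⟨hvu, hu.2.trans_lt hw.2⟩).continuousWithinAt

theorem exists_forall_spacing (hγ : IsPeriodicPseudoOrbit φ ε T l γ) :
    ∃ v, ∀ u, ¬ ContinuousAt γ u → v < u → T ≤ u - v := by
  by_cases h : ∃ v, ¬ ContinuousAt γ v
  · obtain ⟨v, hv⟩ := h
    exact ⟨v, fun u => hγ.spacing v u hv⟩
  · push Not at h
    exact ⟨0, fun u hu => absurd (h u) hu⟩

end IsPeriodicPseudoOrbit

variable {τ σ σ' : ℝ → ℝ} {γ : ℝ → M} {ε : ℝ} {A : C(ℝ, M)}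

theorem apply_upperAdjoint_eq (hmem : ∀ s, (τ s, A s) ∈ realizationSet ε γ)
    (gc : GaloisConnection τ σ) (hs : Function.Surjective τ) {v : ℝ}
    (hright : ContinuousWithinAt γ (Ici v) v) (hc : ∀ᶠ w in 𝓝[>] v, ContinuousAt γ w) :
    A (σ v) = γ v := by
  have hAσ : Tendsto (fun w => A (σ w)) (𝓝[>] v) (𝓝 (A (σ v))) :=
    (A.continuous.tendsto _).comp
      ((continuousWithinAt_upperAdjoint gc v).mono_left (nhdsWithin_mono _ Ioi_subset_Ici_self))
  refine tendsto_nhds_unique hAσ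
    ((hright.mono_left (nhdsWithin_mono _ Ioi_subset_Ici_self)).congr' ?_)
  filter_upwards [hc] with w hw
  have hmem' := (hmem (σ w)).1
  rw [apply_upperAdjoint gc hs] at hmem'
  exact (hmem' hw).symm

theorem mk_seg_mem_realizationSet (hmem : ∀ s, (τ s, A s) ∈ realizationSet ε γ)
    (gc : GaloisConnection τ σ) (gc' : GaloisConnection σ' τ) (hs : Function.Surjective τ)
    (v : ℝ) (u : unitInterval) : (v, seg A (σ' v) (σ v) u) ∈ realizationSet ε γ := by
  have hle := lowerAdjoint_le_upperAdjoint gc gc' hs v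
  have hτ : τ (σ' v + (σ v - σ' v) * u) = v :=
    apply_eq_of_mem_Icc_adjoints gc gc' ⟨by nlinarith [u.2.1], by nlinarith [u.2.2]⟩
  have h := hmem (σ' v + (σ v - σ' v) * u)
  rwa [hτ] at h

open Cover

variable {x₀ : M} {K : Submodule ℤ (H1 ℤ M)} {B : ℝ → Cover x₀ K}

theorem continuousAt_lift_upperAdjoint (hmem : ∀ s, (τ s, A s) ∈ realizationSet ε γ)
    (gc : GaloisConnection τ σ) (gc' : GaloisConnection σ' τ) (hs : Function.Surjective τ)
    (hB : IsLift A B) {v : ℝ} (hγ : ContinuousAt γ v) : ContinuousAt (fun w => B (σ w)) v := by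
  have hconst : seg A (σ' v) (σ v) = ContinuousMap.const _ (B (σ' v)).proj := by
    ext u
    rw [hB.proj, ← seg_zero A (σ' v) (σ v)]
    exact ((mk_seg_mem_realizationSet hmem gc gc' hs v u).1 hγ).trans
      ((mk_seg_mem_realizationSet hmem gc gc' hs v 0).1 hγ).symm
  have hlink := hB.link (σ' v) (σ v)
  rw [hconst] at hlink
  have hleft := (hB.continuous.tendsto _).comp (tendsto_upperAdjoint_nhdsLT gc gc' hs v)
  rw [← hlink.unique (Link.const _)] at hleft
  exact continuousAt_iff_continuous_left'_right'.2 ⟨hleft,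
    (hB.continuous.continuousAt.comp_continuousWithinAt
      (continuousWithinAt_upperAdjoint gc v)).mono Ioi_subset_Ici_self⟩

theorem IsLiftedMetric.eventuallyEq_of_proj {d : Cover x₀ K → Cover x₀ K → ℝ}
    (hd : IsLiftedMetric d) {ι : Type*} {F : Filter ι} {f g : ι → Cover x₀ K} {x : Cover x₀ K}
    (hf : Tendsto f F (𝓝 x)) (hg : Tendsto g F (𝓝 x)) (h : ∀ᶠ i in F, (f i).proj = (g i).proj) :
    f =ᶠ[F] g := by
  obtain ⟨r, hr, hinj⟩ := hd.exists_forall_eq_of_proj_eq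
  filter_upwards [hf.eventually (hd.eventually_lt x (half_pos hr)),
    hg.eventually (hd.eventually_lt x (half_pos hr)), h] with i hfi hgi hi
  refine hinj _ _ ?_ hi
  have := hd.triangle (f i) x (g i)
  rw [hd.symm (f i) x] at this
  linarith

section Metric

variable {φ : Flow ℝ M} {T l ε' : ℝ} {d : Cover x₀ K → Cover x₀ K → ℝ}

theorem eventually_lift_upperAdjoint_eq_liftFlow (hd : IsLiftedMetric d) (hT : 0 < T)
    (hγ : IsPeriodicPseudoOrbit φ ε T l γ) (hmem : ∀ s, (τ s, A s) ∈ realizationSet ε γ)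
    (gc : GaloisConnection τ σ) (hs : Function.Surjective τ) (hB : IsLift A B) (v : ℝ) :
    ∀ᶠ w in 𝓝[>] v, B (σ w) = liftFlow φ (w - v) (B (σ v)) := by
  have hright : Tendsto (fun w => B (σ w)) (𝓝[>] v) (𝓝 (B (σ v))) :=
    (hB.continuous.tendsto _).comp
      ((continuousWithinAt_upperAdjoint gc v).mono_left (nhdsWithin_mono _ Ioi_subset_Ici_self))
  have hflow : Tendsto (fun w => liftFlow φ (w - v) (B (σ v))) (𝓝[>] v) (𝓝 (B (σ v))) := by
    have hc : Continuous fun w => liftFlow φ (w - v) (B (σ v)) :=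
      (isLift_liftFlow φ (B (σ v))).continuous.comp (continuous_sub_right v)
    simpa only [sub_self, liftFlow_zero] using (hc.tendsto v).mono_left nhdsWithin_le_nhds
  have hproj : ∀ w, (B (σ w)).proj = γ w := fun w => (hB.proj _).trans
    (apply_upperAdjoint_eq hmem gc hs (hγ.right_continuous w) (hγ.eventually_continuousAt hT w))
  refine hd.eventuallyEq_of_proj hright hflow ?_
  filter_upwards [hγ.eventually_eq_flow hT v] with w hw
  rw [proj_liftFlow, hproj, hproj, hw]

theorem isPseudoOrbit_lift_upperAdjoint (hd : IsLiftedMetric d) (hT : 0 < T)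
    (hlink : ∀ (z : M) (a : C(unitInterval, M)) (x y : Cover x₀ K),
      (∀ t, a t ∈ Metric.ball z ε) → Link x a y → d x y < ε')
    (hγ : IsPeriodicPseudoOrbit φ ε T l γ) (hmem : ∀ s, (τ s, A s) ∈ realizationSet ε γ)
    (gc : GaloisConnection τ σ) (gc' : GaloisConnection σ' τ) (hs : Function.Surjective τ)
    (hB : IsLift A B) {v : ℝ} (hv : ∀ u, ¬ ContinuousAt γ u → v < u → T ≤ u - v)
    {L : ℝ} (hL : 0 < L) :
    IsPseudoOrbit (liftFlow φ) d ε' T L fun t => B (σ (v + t)) := by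
  have hdisc : ∀ t, ¬ ContinuousAt (fun w => B (σ w)) t → ¬ ContinuousAt γ t := fun t =>
    mt (continuousAt_lift_upperAdjoint hmem gc gc' hs hB)
  have := hd.t2Space
  refine isPseudoOrbit_comp_add (β := fun w => B (σ w)) hT hL
    (fun t => hB.continuous.continuousAt.comp_continuousWithinAt
      (continuousWithinAt_upperAdjoint gc t))
    (fun s t h h' => hγ.spacing s t (hdisc s h) (hdisc t h'))
    (fun s t hst => eq_flow_of_eventually_eq (liftFlow_add φ) (liftFlow_zero φ)
      (fun y => (isLift_liftFlow φ y).continuous) hst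
      fun u _ => eventually_lift_upperAdjoint_eq_liftFlow hd hT hγ hmem gc hs hB u)
    (fun t h => ⟨B (σ' t),
      (hB.continuous.tendsto _).comp (tendsto_upperAdjoint_nhdsLT gc gc' hs t), ?_⟩)
    fun t h => hv t (hdisc t h)
  rw [hd.symm]
  exact hlink (γ t) _ _ _
    (fun u => (mk_seg_mem_realizationSet hmem gc gc' hs t u).2 (hdisc t h)) (hB.link _ _)

theorem upperAdjoint_add_nat_mul (gc : GaloisConnection τ σ) (h : ∀ s, τ (s + 1) = τ s + l)
    (v : ℝ) (k : ℕ) : σ (v + k * l) = σ v + k := by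
  refine gc.u_eq.2 fun x => ?_
  have hx := apply_add_nat_of_apply_add_one h (x - k) k
  rw [sub_add_cancel] at hx
  rw [hx, add_le_add_iff_right, gc.le_iff_le, sub_le_iff_le_add]

end Metric

end Lift

section Periodic

open Cover

variable {M : Type*} [MetricSpace M] [LocallyPathConnectedSpace M] [ConnectedSpace M]
  {x₀ : M} {φ : Flow ℝ M} {T : ℝ} {c : Cocycles M} {K : Submodule ℤ (H1 ℤ M)}
  {d : Cover x₀ K → Cover x₀ K → ℝ}

theorem IsPeriodicPseudoOrbit.exists_lift {ε ε' l : ℝ} {γ : ℝ → M} {Γ : C(unitInterval, M)}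
    (hγ : IsPeriodicPseudoOrbit φ ε T l γ) (hΓ : IsRealization ε l γ Γ) (hd : IsLiftedMetric d)
    (hT : 0 < T) (hK : K ≤ intKer (Submodule.Quotient.mk c))
    (hlink : ∀ (z : M) (a : C(unitInterval, M)) (x y : Cover x₀ K),
      (∀ t, a t ∈ Metric.ball z ε) → Link x a y → d x y < ε') :
    ∃ β : ℝ → Cover x₀ K, (∀ L, 0 < L → IsPseudoOrbit (liftFlow φ) d ε' T L β) ∧
      ∀ k : ℕ, (β (k * l)).proj = (β 0).proj ∧
        primitive c (β (k * l)) = primitive c (β 0) + k * curveValue c Γ := by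
  have hl := hγ.length_pos
  obtain ⟨A, τ, hA, rfl⟩ := hΓ.exists_isPeriodicRealization hl.le hγ.periodic
  have hs := surjective_of_apply_add_one hl hA.continuous_time hA.time_add_one
  obtain ⟨σ, gc⟩ := exists_upperAdjoint hA.continuous_time hA.monotone_time hs
  obtain ⟨σ', gc'⟩ := exists_lowerAdjoint hA.continuous_time hA.monotone_time hs
  obtain ⟨v, hv⟩ := hγ.exists_forall_spacing
  obtain ⟨p, hp⟩ := PathSpace.exists_endpoint (x₀ := x₀) (A 0)
  obtain ⟨B, hB, -⟩ := exists_isLift (Cover.mk K p) A hp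
  refine ⟨fun t => B (σ (v + t)), fun L hL =>
    isPseudoOrbit_lift_upperAdjoint hd hT hlink hγ hA.mem gc gc' hs hB hv hL, fun k => ?_⟩
  simp only [upperAdjoint_add_nat_mul gc hA.time_add_one, add_zero]
  constructor
  · rw [hB.proj, hB.proj]
    simpa only [mul_one] using hA.periodic.nat_mul k (σ v)
  · rw [(hB.link _ _).primitive_eq hK, ← curveValue_seg_add_nat_mul c hA.periodic (σ v), mul_one]

variable [CompactSpace M]

theorem IsQuasiLyapunov.exists_forall_periodic (hd : IsLiftedMetric d) (hT : 0 < T)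
    (hK : K ≤ intKer (Submodule.Quotient.mk c))
    (h : IsQuasiLyapunov φ T d (Submodule.Quotient.mk c)) :
    ∃ ε > 0, ∀ (l : ℝ) (γ : ℝ → M), IsPeriodicPseudoOrbit φ ε T l γ →
      ∀ h, IsClassOf ε l γ h → eval ℝ (Submodule.Quotient.mk c) h ≤ 0 := by
  obtain ⟨f, hfc, hf⟩ := exists_continuous_isEquivariant hd hK
  obtain ⟨C, -, ε', hε', hQL⟩ := h f hfc hf
  obtain ⟨ε, hε, hlink⟩ := hd.exists_forall_link_lt hε'
  refine ⟨ε, hε, ?_⟩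
  rintro l γ hγ _ ⟨Γ, hΓ, rfl⟩
  rw [eval_loopClass]
  obtain ⟨β, hβ, hval⟩ := hγ.exists_lift hΓ hd hT hK hlink
  by_contra! hpos
  obtain ⟨k, hk⟩ := exists_nat_gt (C / curveValue c Γ)
  rw [div_lt_iff₀ hpos] at hk
  have hkl : 0 ≤ k * l := mul_nonneg k.cast_nonneg hγ.length_pos.le
  obtain ⟨hproj, hprim⟩ := hval k
  have hgrowth := (isEquivariant_iff_sub_eq_sub hK).1 hf _ _ hproj.symm
  have hbound := hQL (k * l + 1) β (hβ _ (by linarith)) (k * l) ⟨hkl, by linarith⟩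
  linarith

end Periodic

/-! ### Asymptotic directions -/

section Directions

variable {M : Type*} [MetricSpace M]

theorem IsPeriodicPseudoOrbit.mono {φ : Flow ℝ M} {ε ε' T l : ℝ} {γ : ℝ → M}
    (h : IsPeriodicPseudoOrbit φ ε' T l γ) (hε : ε' ≤ ε) : IsPeriodicPseudoOrbit φ ε T l γ :=
  { h with
    jump := fun u hu => (h.jump u hu).imp fun _ hy => ⟨hy.1, hy.2.trans_le hε⟩ }

theorem IsClassOf.mono {ε ε' l : ℝ} {γ : ℝ → M} {h : H1 ℝ M} (hh : IsClassOf ε' l γ h)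
    (hε : ε' ≤ ε) : IsClassOf ε l γ h := by
  obtain ⟨Γ, ⟨hc, τ, hm, hτ, hg⟩, rfl⟩ := hh
  exact ⟨Γ, ⟨hc, τ, hm, hτ, fun s =>
    ⟨(hg s).1, fun hs => Metric.ball_subset_ball hε ((hg s).2 hs)⟩⟩, rfl⟩

theorem eventually_isSmall_and_forall_periodic {φ : Flow ℝ M} {T ε₀ ε : ℝ} {α : Cohomology M}
    (hε₀ : 0 < ε₀) (hsmall : IsSmall M ε₀) (hε : 0 < ε)
    (h : ∀ (l : ℝ) (γ : ℝ → M), IsPeriodicPseudoOrbit φ ε T l γ →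
      ∀ h, IsClassOf ε l γ h → eval ℝ α h ≤ 0) :
    ∀ᶠ ε in 𝓝[>] (0 : ℝ), IsSmall M ε ∧
      ∀ (l : ℝ) (γ : ℝ → M), IsPeriodicPseudoOrbit φ ε T l γ →
        ∀ h, IsClassOf ε l γ h → eval ℝ α h ≤ 0 := by
  filter_upwards [Ioo_mem_nhdsGT (lt_min hε hε₀)] with ε' hε'
  have hle := lt_min_iff.1 hε'.2
  exact ⟨hsmall.mono hle.2.le, fun l γ hγ a ha => h l γ (hγ.mono hle.1.le) a (ha.mono hle.1.le)⟩

theorem forall_pseudoDirections_iff (φ : Flow ℝ M) (ε T : ℝ) (α : Cohomology M) :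
    (∀ v ∈ pseudoDirections φ ε T, eval ℝ α v ≤ 0) ↔
      ∀ (l : ℝ) (γ : ℝ → M), IsPeriodicPseudoOrbit φ ε T l γ →
        ∀ h, IsClassOf ε l γ h → eval ℝ α h ≤ 0 := by
  let _ : TopologicalSpace (H1 ℝ M) := moduleTopology ℝ (H1 ℝ M)
  have : IsModuleTopology ℝ (H1 ℝ M) := ⟨rfl⟩
  constructor
  · intro h l γ hγ a ha
    have hmem := h (l⁻¹ • a) (subset_closure ⟨l, γ, a, hγ, ha, rfl⟩)
    rw [map_smul, smul_eq_mul] at hmem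
    exact nonpos_of_mul_nonpos_right hmem (inv_pos.2 hγ.length_pos)
  · intro h
    have hc : Continuous (eval ℝ α) := IsModuleTopology.continuous_of_linearMap _
    refine closure_minimal ?_ (isClosed_le hc continuous_const)
    rintro _ ⟨l, γ, a, hγ, ha, rfl⟩
    change eval ℝ α (l⁻¹ • a) ≤ 0
    rw [map_smul, smul_eq_mul]
    exact mul_nonpos_of_nonneg_of_nonpos (inv_nonneg.2 hγ.length_pos.le) (h l γ hγ a ha)

end Directions

end QuasiLyapunov

end

theorem lemma3_general {M : Type*} [MetricSpace M] [CompactSpace M] [ConnectedSpace M]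
    [LocallyPathConnectedSpace M] (hsmall : ∃ ε > 0, IsSmall M ε) (φ : Flow ℝ M) {T : ℝ}
    (hT : 0 < T) {x₀ : M} {α : Cohomology M} {K K' : Submodule ℤ (H1 ℤ M)}
    (hK : K ≤ intKer α) (hK' : K' ≤ intKer α)
    {d : Cover x₀ K → Cover x₀ K → ℝ} (hd : IsLiftedMetric d)
    {d' : Cover x₀ K' → Cover x₀ K' → ℝ} (hd' : IsLiftedMetric d') :
    List.TFAE [
      IsQuasiLyapunov φ T d α,
      IsQuasiLyapunov φ T d' α,
      ∃ ε > 0, IsSmall M ε ∧ ∀ v ∈ pseudoDirections φ ε T, eval ℝ α v ≤ 0,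
      ∀ᶠ ε in 𝓝[>] (0 : ℝ), IsSmall M ε ∧ ∀ v ∈ pseudoDirections φ ε T, eval ℝ α v ≤ 0,
      ∃ ε > 0, IsSmall M ε ∧ ∀ (l : ℝ) (γ : ℝ → M), IsPeriodicPseudoOrbit φ ε T l γ →
        ∀ h, IsClassOf ε l γ h → eval ℝ α h ≤ 0,
      ∀ᶠ ε in 𝓝[>] (0 : ℝ), IsSmall M ε ∧
        ∀ (l : ℝ) (γ : ℝ → M), IsPeriodicPseudoOrbit φ ε T l γ →
          ∀ h, IsClassOf ε l γ h → eval ℝ α h ≤ 0] := by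
  obtain ⟨ε₀, hε₀, hsmall⟩ := hsmall
  obtain ⟨c, rfl⟩ := Submodule.Quotient.mk_surjective _ α
  simp only [forall_pseudoDirections_iff]
  tfae_have 1 → 6 := fun H =>
    have ⟨_, hε, h⟩ := H.exists_forall_periodic hd hT hK
    eventually_isSmall_and_forall_periodic hε₀ hsmall hε h
  tfae_have 2 → 6 := fun H =>
    have ⟨_, hε, h⟩ := H.exists_forall_periodic hd' hT hK'
    eventually_isSmall_and_forall_periodic hε₀ hsmall hε h
  tfae_have 6 → 5 := fun H =>
    have ⟨ε, h, hε⟩ := (H.and self_mem_nhdsWithin).exists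
    ⟨ε, hε, h⟩
  tfae_have 5 → 1 := fun ⟨_, hε, _, h⟩ => isQuasiLyapunov_of_forall_periodic hd hε hT hK h
  tfae_have 5 → 2 := fun ⟨_, hε, _, h⟩ => isQuasiLyapunov_of_forall_periodic hd' hε hT hK' h
  tfae_have 3 ↔ 5 := Iff.rfl
  tfae_have 4 ↔ 6 := Iff.rfl
  tfae_finish

theorem lemma3 {E H M : Type*} [NormedAddCommGroup E] [NormedSpace ℝ E] [FiniteDimensional ℝ E]
    [TopologicalSpace H] (I : ModelWithCorners ℝ E H)
    [MetricSpace M] [CompactSpace M] [ConnectedSpace M] [ChartedSpace H M]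
    (φ : Flow ℝ M) (T : ℝ) (hT : 0 < T) (x₀ : M) (α : Cohomology M)
    (d : Cover x₀ (intKer α) → Cover x₀ (intKer α) → ℝ) (hd : IsLiftedMetric d)
    (d' : Cover x₀ (⊥ : Submodule ℤ (H1 ℤ M)) → Cover x₀ (⊥ : Submodule ℤ (H1 ℤ M)) → ℝ)
    (hd' : IsLiftedMetric d') :
    List.TFAE [
      IsQuasiLyapunov φ T d α,
      IsQuasiLyapunov φ T d' α,
      ∃ ε > 0, IsSmall M ε ∧ ∀ v ∈ pseudoDirections φ ε T, eval ℝ α v ≤ 0,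
      ∀ᶠ ε in 𝓝[>] (0 : ℝ), IsSmall M ε ∧ ∀ v ∈ pseudoDirections φ ε T, eval ℝ α v ≤ 0,
      ∃ ε > 0, IsSmall M ε ∧ ∀ (l : ℝ) (γ : ℝ → M), IsPeriodicPseudoOrbit φ ε T l γ →
        ∀ h, IsClassOf ε l γ h → eval ℝ α h ≤ 0,
      ∀ᶠ ε in 𝓝[>] (0 : ℝ), IsSmall M ε ∧
        ∀ (l : ℝ) (γ : ℝ → M), IsPeriodicPseudoOrbit φ ε T l γ →
          ∀ h, IsClassOf ε l γ h → eval ℝ α h ≤ 0] := by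
  have := locallyPathConnectedSpace_of_modelWithCorners I M
  exact lemma3_general (exists_isSmall I M) φ hT le_rfl bot_le hd hd'
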